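/- **Theorem (Lyapunov inequality).** Let $1/2<\alpha\le 1$, $s\in(0,1)$, $N\ge 1$, $C>0$, $-\infty<a<b<\infty$, let $\Omega\subset\mathbb R^N$ be a bounded open set, $D=(a,b)\times\Omega$, and let $q:[a,b]\to\mathbb R$ be continuous. On $(a,b)$ let $$D_{a+}^\alpha f=\frac{d}{dx}I_{a+}^{1-\alpha}f,\qquad \mathcal D_{b-}^\alpha f=-I_{b-}^{1-\alpha}f',$$ $$I_{a+}^{\beta}f(x)=\frac1{\Gamma(\beta)}\int_a^x(x-t)^{\beta-1}f(t)\,dt,\qquad I_{b-}^{\beta}f(x)=\frac1{\Gamma(\beta)}\int_x^b(t-x)^{\beta-1}f(t)\,dt\quad(\beta>0),$$ and $I_{a+}^0f=I_{b-}^0f=f$. Let $$(-\Delta)^s f(y)=C\int_{\mathbb R^N}\frac{f(y)-f(\xi)}{|y-\xi|^{N+2s}}\,d\xi$$ be the fractional Laplacian with normalisation constant $C$, taken in the weak sense: let $X$ be the set of real functions in $H^s(\mathbb R^N)$ that vanish a.e. outside $\Omega$; for $f\in X$ and $h\in L^2(\Omega)$, "$(-\Delta)^sf=h$ in $\Omega$"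 means $$\frac C2\iint_{\mathbb R^N\times\mathbb R^N}\frac{(f(y)-f(\xi))(\psi(y)-\psi(\xi))}{|y-\xi|^{N+2s}}\,dy\,d\xi=\int_\Omega h\,\psi\,dy\qquad\text{for all }\psi\in X .$$ Let $\lambda_1(\Omega)$ be the first (smallest) eigenvalue of the fractional Dirichlet Laplacian, i.e. the infimum of the real $\lambda$ for which $(-\Delta)^s\varphi=\lambda\varphi$ in $\Omega$ for some $\varphi\in X$ that is not a.e. zero. Put $$K(x,t)=\frac1{\Gamma^2(\alpha)}\int_{\max\{x,t\}}^b(r-x)^{\alpha-1}(r-t)^{\alpha-1}\,dr,\qquad G(x,t)=K(x,t)-\frac{K(a,t)K(x,a)}{K(a,a)} .$$ Suppose that the Dirichlet problem $$D_{a+,x}^\alpha\mathcal D_{b-,x}^\alpha u(x,y)+(-\Delta)^s_yu(x,y)=q(x)u(x,y)\ \text{ in }D,\qquad u(a,y)=u(b,y)=0\ (y\in\Omega),\qquad u(x,y)=0\ (y\notin\Omega),$$ has a nontrivial (not a.e. zero in $D$) real strong solution $u\in L^2(D)$. Here strong solution means: $D_{a+,x}^\alpha\mathcal D_{b-,x}^\alpha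 u\in L^2(D)$; for a.e. $y\in\Omega$ the function $u(\cdot,y)$ is absolutely continuous on $[a,b]$ with $u(a,y)=u(b,y)=0$, and $I_{a+,x}^{1-\alpha}\mathcal D_{b-,x}^\alpha u(\cdot,y)$ is absolutely continuous on every compact subinterval of $(a,b)$; for a.e. $x\in(a,b)$ one has $u(x,\cdot)\in X$ and $(-\Delta)^s_yu(x,\cdot)\in L^2(\Omega)$ exists, and the equation holds for a.e. $y\in\Omega$. Then $0<\sup_{a<x<b}G(x,x)<\infty$ and $$\int_a^b|q(x)-\lambda_1(\Omega)|\,dx\ \ge\ \Bigl(\sup_{a<x<b}G(x,x)\Bigr)^{-1}.$$ -/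

import Mathlib

open MeasureTheory Set

noncomputable section

namespace CylLyapunov

/-! ### One-dimensional fractional calculus on an interval -/

/-- Left Riemann-Liouville integral `I_{a+}^β f`, with the usual convention that
`I_{a+}^0` is the identity. -/
def rlIntegralLeft (β a : ℝ) (f : ℝ → ℝ) (x : ℝ) : ℝ :=
  if β = 0 then f x
  else (Real.Gamma β)⁻¹ * ∫ t in a..x, (x - t) ^ (β - 1) * f t

/-- Right Riemann-Liouville integral `I_{b-}^β f`, with the usual convention that
`I_{b-}^0` is the identity. -/
def rlIntegralRight (β b : ℝ) (f : ℝ → ℝ) (x : ℝ) : ℝ :=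
  if β = 0 then f x
  else (Real.Gamma β)⁻¹ * ∫ t in x..b, (t - x) ^ (β - 1) * f t

/-- Left Riemann-Liouville derivative `D_{a+}^α f = d/dx I_{a+}^{1-α} f`, `0 < α ≤ 1`. -/
def rlDerivLeft (α a : ℝ) (f : ℝ → ℝ) (x : ℝ) : ℝ :=
  deriv (rlIntegralLeft (1 - α) a f) x

/-- Right Caputo derivative `- I_{b-}^{1-α} f'`, `0 < α ≤ 1`. The sign is the one for
which `I_{b-}^α` of it is `f - f b`, and for which the composition with `D_{a+}^α`
is a positive operator (it is `- f''` when `α = 1`). -/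
def caputoDerivRight (α b : ℝ) (f : ℝ → ℝ) (x : ℝ) : ℝ :=
  -rlIntegralRight (1 - α) b (deriv f) x

/-- The kernel
`K(x,t) = Γ(α)⁻² ∫_{max(x,t)}^b (s-x)^(α-1) (s-t)^(α-1) ds`. -/
def kernelK (α b x t : ℝ) : ℝ :=
  1 / Real.Gamma α ^ 2 * ∫ r in (max x t)..b, (r - x) ^ (α - 1) * (r - t) ^ (α - 1)

/-- The Green function `G(x,t) = K(x,t) - K(a,t) K(x,a) / K(a,a)`. -/
def greenG (α a b x t : ℝ) : ℝ :=
  kernelK α b x t - kernelK α b a t * kernelK α b x a / kernelK α b a a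

/-- Regularity in which the composition of `D_{a+}^α` with the right Caputo derivative is
applied to `f` on `(a,b)`: `f` is absolutely continuous on `[a,b]`, and the function that
`D_{a+}^α` differentiates is absolutely continuous on every compact subinterval of `(a,b)`. -/
def IsAdmissible (α a b : ℝ) (f : ℝ → ℝ) : Prop :=
  AbsolutelyContinuousOnInterval f a b ∧
  ∀ c d : ℝ, a < c → c < d → d < b →
    AbsolutelyContinuousOnInterval
      (rlIntegralLeft (1 - α) a (caputoDerivRight α b f)) c d

/-! ### The fractional Dirichlet Laplacian -/

variable {N : ℕ}

/-- The energy space of the Dirichlet problem: functions in `H^s(ℝ^N)` (that is, in `L²` with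
finite Gagliardo seminorm) that vanish almost everywhere outside `Ω`. -/
def MemEnergy (s : ℝ) (Ω : Set (EuclideanSpace ℝ (Fin N)))
    (f : EuclideanSpace ℝ (Fin N) → ℝ) : Prop :=
  MemLp f 2 volume ∧
  Integrable (fun p : EuclideanSpace ℝ (Fin N) × EuclideanSpace ℝ (Fin N) =>
    (f p.1 - f p.2) ^ 2 / ‖p.1 - p.2‖ ^ ((N : ℝ) + 2 * s)) volume ∧
  ∀ᵐ y ∂(volume : Measure (EuclideanSpace ℝ (Fin N))), y ∉ Ω → f y = 0

/-- The bilinear form of `(-Δ)^s` with normalisation constant `C`: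
`C/2 ∬ (f(y)-f(ξ)) (g(y)-g(ξ)) / |y-ξ|^(N+2s) dy dξ`. -/
def energyForm (C s : ℝ) (f g : EuclideanSpace ℝ (Fin N) → ℝ) : ℝ :=
  C / 2 * ∫ p : EuclideanSpace ℝ (Fin N) × EuclideanSpace ℝ (Fin N),
    (f p.1 - f p.2) * (g p.1 - g p.2) / ‖p.1 - p.2‖ ^ ((N : ℝ) + 2 * s)

/-- `(-Δ)^s f = h` in `Ω` and `f = 0` outside `Ω`, in the weak sense, with `h ∈ L²(Ω)`:
here `(-Δ)^s f(y) = C ∫ (f(y)-f(ξ)) / |y-ξ|^(N+2s) dξ`, which is tested against the functions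
of the energy space. -/
def HasFracLaplacian (C s : ℝ) (Ω : Set (EuclideanSpace ℝ (Fin N)))
    (f h : EuclideanSpace ℝ (Fin N) → ℝ) : Prop :=
  MemEnergy s Ω f ∧ MemLp h 2 (volume.restrict Ω) ∧
  ∀ ψ : EuclideanSpace ℝ (Fin N) → ℝ, MemEnergy s Ω ψ →
    energyForm C s f ψ = ∫ y in Ω, h y * ψ y

/-- `lam` is an eigenvalue of the fractional Dirichlet Laplacian in `Ω`. -/
def IsEigenvalue (C s : ℝ) (Ω : Set (EuclideanSpace ℝ (Fin N))) (lam : ℝ) : Prop :=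
  ∃ φ : EuclideanSpace ℝ (Fin N) → ℝ,
    ¬ (φ =ᵐ[volume.restrict Ω] 0) ∧ HasFracLaplacian C s Ω φ (fun y => lam * φ y)

/-- The first (smallest) eigenvalue `λ₁(Ω)` of the fractional Dirichlet Laplacian. -/
def firstEigenvalue (C s : ℝ) (Ω : Set (EuclideanSpace ℝ (Fin N))) : ℝ :=
  sInf {lam : ℝ | IsEigenvalue C s Ω lam}

/-! ### The operator on the cylinder -/

/-- The operator `D_{a+,x}^α` composed with the right Caputo derivative in `x`, applied to
`u = u(x,y)`. -/
def cylOpX (α a b : ℝ) (u : ℝ → EuclideanSpace ℝ (Fin N) → ℝ)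
    (x : ℝ) (y : EuclideanSpace ℝ (Fin N)) : ℝ :=
  rlDerivLeft α a (caputoDerivRight α b (fun t => u t y)) x

/-- `u` is an `L²` strong solution of the Dirichlet problem
`D_{a+,x}^α D_{b-,x}^α u + (-Δ)_y^s u = q(x) u` in `(a,b) × Ω`,
`u(a,y) = u(b,y) = 0` for `y ∈ Ω`, `u(x,y) = 0` for `y ∉ Ω`. -/
structure IsDirichletSolution (α s C a b : ℝ) (Ω : Set (EuclideanSpace ℝ (Fin N)))
    (q : ℝ → ℝ) (u : ℝ → EuclideanSpace ℝ (Fin N) → ℝ) : Prop where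
  memLp : MemLp (Function.uncurry u) 2 (volume.restrict (Ioo a b ×ˢ Ω))
  admissible : ∀ᵐ y ∂(volume.restrict Ω), IsAdmissible α a b (fun x => u x y)
  boundary : ∀ᵐ y ∂(volume.restrict Ω), u a y = 0 ∧ u b y = 0
  memLp_opX : MemLp (Function.uncurry (cylOpX α a b u)) 2 (volume.restrict (Ioo a b ×ˢ Ω))
  equation : ∃ w : ℝ → EuclideanSpace ℝ (Fin N) → ℝ,
    ∀ᵐ x ∂(volume.restrict (Ioo a b)),
      HasFracLaplacian C s Ω (u x) (w x) ∧
      ∀ᵐ y ∂(volume.restrict Ω), cylOpX α a b u x y + w x y = q x * u x y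

end CylLyapunov

end

/-!
Write `h` for the result of applying the two fractional derivatives in `x` to `u`, and `λ₁` for the
first eigenvalue.

*On the lines parallel to the axis.* For almost every `y`, put `f = u(·, y)` and let `v` be its
right Caputo derivative. Then `Γ(α) f(x) = ∫_x^b (t - x)^(α-1) v(t) dt`
(`integral_rpow_mul_caputoDerivRight`), and Abel's equation gives
`v = c (x - a)^(α-1) + Γ(α)⁻¹ ∫_a^x (x - t)^(α-1) h(t) dt` (`exists_ae_eq_rpow_add_integral`). Since
`α > 1/2` and `h` is square integrable, so is `v`. The condition `f(a) = 0` says that `v` is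
orthogonal to `(t - a)^(α-1)`. Two consequences follow: testing `h` against `f` and using that
the left and right fractional integrals are adjoint, `∫ h f = ∫ v²`; and, `G` being the reproducing
kernel of the space of such `f`, the Cauchy-Schwarz inequality gives `f(x)² ≤ G(x,x) ∫ v²`. Hence
`f(x)² ≤ G(x,x) ∫ h f` (`sq_le_greenG_mul_integral`).

*On the slices orthogonal to the axis.* The form of the fractional Laplacian dominates `λ₁` times
the square of the `L²` norm (`firstEigenvalue_mul_le`). Because `λ₁` is defined as an infimum of
eigenvalues, this requires a minimiser of the Rayleigh quotient, which the direct method provides: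
a Poincaré inequality on small cubes shows that bounded sequences of the energy space are
precompact in `L²` (`exists_subseq_integral_sub_sq_le`), the Gagliardo seminorm is lower
semicontinuous by Fatou's lemma, and a minimiser is an eigenfunction. Testing the equation with
`u(x, ·)` gives `∫_Ω h u dy ≤ (q(x) - λ₁) ∫_Ω u(x,y)² dy` for almost every `x`.

*Together.* With `S = sup G(x,x)` and `I = ∫∫ h u`, the first part gives `∫_Ω u(x,y)² dy ≤ S I`, and
the second one, integrated in `x`, gives `I ≤ S I ∫ |q - λ₁|`. Here `S I > 0`, since otherwise `u`
would vanish almost everywhere.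
-/

noncomputable section

namespace CylLyapunov

/-! ### Iterated Riemann-Liouville integrals -/

/-- Euler's beta integral on an arbitrary interval. -/
theorem integral_rpow_mul_rpow {p q : ℝ} (hp : 0 < p) (hq : 0 < q) {r x : ℝ} (hrx : r < x) :
    ∫ t in r..x, (x - t) ^ (p - 1) * (t - r) ^ (q - 1) =
      ProbabilityTheory.beta p q * (x - r) ^ (p + q - 1) := by
  have hL : 0 < x - r := sub_pos.2 hrx
  have h1 := Complex.betaIntegral_scaled (q : ℂ) (p : ℂ) hL
  have h2 : (∫ t in (0 : ℝ)..(x - r), (t : ℂ) ^ ((q : ℂ) - 1) * (((x - r : ℝ) : ℂ) - t) ^ ((p : ℂ) - 1))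
      = ((∫ t in (0 : ℝ)..(x - r), (x - r - t) ^ (p - 1) * t ^ (q - 1) : ℝ) : ℂ) := by
    rw [← intervalIntegral.integral_ofReal]
    refine intervalIntegral.integral_congr fun t ht => ?_
    rw [uIcc_of_le hL.le] at ht
    have e1 : (q : ℂ) - 1 = ((q - 1 : ℝ) : ℂ) := by push_cast; ring
    have e2 : (p : ℂ) - 1 = ((p - 1 : ℝ) : ℂ) := by push_cast; ring
    simp only [e1, e2]
    rw [← Complex.ofReal_sub, ← Complex.ofReal_cpow ht.1,
      ← Complex.ofReal_cpow (sub_nonneg.2 ht.2)]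
    push_cast
    ring
  rw [h2] at h1
  have h3 := congrArg Complex.re h1
  have e3 : (q : ℂ) + p - 1 = ((q + p - 1 : ℝ) : ℂ) := by push_cast; ring
  rw [Complex.ofReal_re, e3, ← Complex.ofReal_cpow hL.le, Complex.re_ofReal_mul,
    ← ProbabilityTheory.beta_eq_betaIntegralReal _ _ hq hp] at h3
  have h4 := intervalIntegral.integral_comp_sub_right (a := r) (b := x)
    (fun t => (x - r - t) ^ (p - 1) * t ^ (q - 1)) r
  simp only [sub_self, sub_sub_sub_cancel_right] at h4
  rw [h4, h3, add_comm q p, mul_comm]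
  congr 1
  unfold ProbabilityTheory.beta
  rw [mul_comm, add_comm]

theorem intervalIntegrable_rpow_mul_rpow {p q : ℝ} (hp : 0 < p) (hq : 0 < q) {r x : ℝ}
    (hrx : r ≤ x) :
    IntervalIntegrable (fun t => (x - t) ^ (p - 1) * (t - r) ^ (q - 1)) volume r x := by
  rcases hrx.eq_or_lt with rfl | hrx
  · exact IntervalIntegrable.refl
  refine not_imp_comm.1 intervalIntegral.integral_undef ?_
  rw [integral_rpow_mul_rpow hp hq hrx]
  exact (mul_pos (ProbabilityTheory.beta_pos hp hq) (Real.rpow_pos_of_pos (sub_pos.2 hrx) _)).ne'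

/-- The integrand of an iterated Riemann-Liouville integral of orders `q` and `p` on `(a, x)`,
extended by zero from the triangle `r ≤ t` to the square. -/
def triangleKernel (p q x : ℝ) (F : ℝ → ℝ) (z : ℝ × ℝ) : ℝ :=
  {z : ℝ × ℝ | z.2 ≤ z.1}.indicator
    (fun z => (x - z.1) ^ (p - 1) * (z.1 - z.2) ^ (q - 1) * F z.2) z

theorem triangleKernel_section_left {p q x : ℝ} (F : ℝ → ℝ) (t : ℝ) :
    (fun r => triangleKernel p q x F (t, r)) =
      (Iic t).indicator (fun r => (x - t) ^ (p - 1) * (t - r) ^ (q - 1) * F r) := by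
  ext r
  by_cases h : r ≤ t <;> simp [triangleKernel, indicator, h]

theorem triangleKernel_section_right {p q x : ℝ} (F : ℝ → ℝ) (r : ℝ) :
    (fun t => triangleKernel p q x F (t, r)) =
      (Ici r).indicator (fun t => (x - t) ^ (p - 1) * (t - r) ^ (q - 1) * F r) := by
  ext t
  by_cases h : r ≤ t <;> simp [triangleKernel, indicator, h]

theorem Ioc_inter_Ici_ae {a x r : ℝ} (har : a < r) :
    (Ici r ∩ Ioc a x : Set ℝ) =ᵐ[volume] Ioc r x := by
  have : (Ici r ∩ Ioc a x : Set ℝ) = Icc r x := by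
    ext t; simp only [mem_inter_iff, mem_Ici, mem_Ioc, mem_Icc]
    constructor
    · rintro ⟨h1, h2, h3⟩; exact ⟨h1, h3⟩
    · rintro ⟨h1, h3⟩; exact ⟨h1, har.trans_le h1, h3⟩
  rw [this]
  exact Ioc_ae_eq_Icc.symm

theorem setIntegral_triangleKernel_right {p q : ℝ} (hp : 0 < p) (hq : 0 < q) {a x : ℝ}
    (F : ℝ → ℝ) {r : ℝ} (hr : r ∈ Ioo a x) :
    ∫ t in Ioc a x, triangleKernel p q x F (t, r) =
      ProbabilityTheory.beta p q * (x - r) ^ (p + q - 1) * F r := by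
  rw [triangleKernel_section_right, integral_indicator measurableSet_Ici,
    Measure.restrict_restrict measurableSet_Ici, setIntegral_congr_set (Ioc_inter_Ici_ae hr.1),
    integral_mul_const, ← intervalIntegral.integral_of_le hr.2.le,
    integral_rpow_mul_rpow hp hq hr.2]

theorem integrable_triangleKernel {p q : ℝ} (hp : 0 < p) (hq : 0 < q) (hpq : 1 ≤ p + q)
    {a x : ℝ} {F : ℝ → ℝ} (hF : IntegrableOn F (Ioc a x)) :
    Integrable (triangleKernel p q x F)
      ((volume.restrict (Ioc a x)).prod (volume.restrict (Ioc a x))) := by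
  have hmeas : AEStronglyMeasurable (triangleKernel p q x F)
      ((volume.restrict (Ioc a x)).prod (volume.restrict (Ioc a x))) := by
    refine AEStronglyMeasurable.indicator ?_ (measurableSet_le measurable_snd measurable_fst)
    refine AEStronglyMeasurable.mul ?_ hF.aestronglyMeasurable.comp_snd
    refine Measurable.aestronglyMeasurable ?_
    fun_prop
  have hlt : ∀ᵐ r ∂(volume.restrict (Ioc a x)), r ∈ Ioo a x := by
    rw [← restrict_Ioo_eq_restrict_Ioc]
    exact ae_restrict_mem measurableSet_Ioo
  rw [integrable_prod_iff' hmeas]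
  constructor
  · filter_upwards [hlt] with r hr
    rw [triangleKernel_section_right, integrable_indicator_iff measurableSet_Ici, IntegrableOn,
      Measure.restrict_restrict measurableSet_Ici]
    refine Integrable.mul_const ?_ _
    have := (intervalIntegrable_rpow_mul_rpow hp hq hr.2.le).1
    exact this.congr_set_ae (Ioc_inter_Ici_ae hr.1)
  · have hnorm : ∀ r ∈ Ioo a x, ∫ t in Ioc a x, ‖triangleKernel p q x F (t, r)‖ =
        ProbabilityTheory.beta p q * (x - r) ^ (p + q - 1) * |F r| := by
      intro r hr
      rw [← setIntegral_triangleKernel_right hp hq (fun r => |F r|) hr]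
      refine setIntegral_congr_fun measurableSet_Ioc fun t ht => ?_
      by_cases h : r ≤ t
      · simp only [triangleKernel, indicator, mem_ofPred_eq, h, if_true, norm_mul, Real.norm_eq_abs]
        rw [abs_of_nonneg (Real.rpow_nonneg (sub_nonneg.2 ht.2) _),
          abs_of_nonneg (Real.rpow_nonneg (sub_nonneg.2 h) _)]
      · simp [triangleKernel, indicator, h]
    have hb : Integrable (fun r => (ProbabilityTheory.beta p q * (x - r) ^ (p + q - 1)) * |F r|)
        (volume.restrict (Ioc a x)) := by
      refine Integrable.bdd_mul (c := ProbabilityTheory.beta p q * (x - a) ^ (p + q - 1))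
        hF.abs ?_ ?_
      · refine Measurable.aestronglyMeasurable ?_
        fun_prop
      · filter_upwards [hlt] with r hr
        rw [Real.norm_eq_abs, abs_of_nonneg (mul_nonneg (ProbabilityTheory.beta_pos hp hq).le
          (Real.rpow_nonneg (sub_nonneg.2 hr.2.le) _))]
        gcongr
        · exact (ProbabilityTheory.beta_pos hp hq).le
        · exact sub_nonneg.2 hr.2.le
        · exact hr.1.le
    refine hb.congr ?_
    filter_upwards [hlt] with r hr
    exact (hnorm r hr).symm

theorem setIntegral_triangleKernel_left {p q a x : ℝ} (F : ℝ → ℝ) {t : ℝ} (ht : t ∈ Ioc a x) :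
    ∫ r in Ioc a x, triangleKernel p q x F (t, r) =
      (x - t) ^ (p - 1) * ∫ r in a..t, (t - r) ^ (q - 1) * F r := by
  have hset : Iic t ∩ Ioc a x = Ioc a t := by
    ext r; simp only [mem_inter_iff, mem_Iic, mem_Ioc]
    constructor
    · rintro ⟨h1, h2, -⟩; exact ⟨h2, h1⟩
    · rintro ⟨h1, h2⟩; exact ⟨h2, h1, h2.trans ht.2⟩
  rw [triangleKernel_section_left, integral_indicator measurableSet_Iic,
    Measure.restrict_restrict measurableSet_Iic, hset, intervalIntegral.integral_of_le ht.1.le,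
    ← integral_const_mul]
  simp only [mul_assoc]

/-- The Riemann-Liouville integral of an integrable function is integrable. -/
theorem intervalIntegrable_integral_rpow_mul {q : ℝ} (hq : 0 < q) {a b : ℝ} (hab : a ≤ b)
    {F : ℝ → ℝ} (hF : IntervalIntegrable F volume a b) :
    IntervalIntegrable (fun t => ∫ r in a..t, (t - r) ^ (q - 1) * F r) volume a b := by
  rw [intervalIntegrable_iff_integrableOn_Ioc_of_le hab] at hF ⊢
  have h := (integrable_triangleKernel one_pos hq (by linarith) hF).integral_prod_left
  refine h.congr ?_
  filter_upwards [ae_restrict_mem measurableSet_Ioc] with t ht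
  rw [setIntegral_triangleKernel_left F ht]
  simp

/-- The semigroup property of the left Riemann-Liouville integrals. -/
theorem integral_rpow_mul_integral_rpow_mul {p q : ℝ} (hp : 0 < p) (hq : 0 < q)
    (hpq : 1 ≤ p + q) {a x : ℝ} (hax : a ≤ x) {F : ℝ → ℝ} (hF : IntervalIntegrable F volume a x) :
    ∫ t in a..x, (x - t) ^ (p - 1) * ∫ r in a..t, (t - r) ^ (q - 1) * F r =
      ProbabilityTheory.beta p q * ∫ r in a..x, (x - r) ^ (p + q - 1) * F r := by
  rw [intervalIntegrable_iff_integrableOn_Ioc_of_le hax] at hF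
  have h := integral_integral_swap (f := fun t r => triangleKernel p q x F (t, r))
    (integrable_triangleKernel hp hq hpq hF)
  rw [intervalIntegral.integral_of_le hax, intervalIntegral.integral_of_le hax,
    ← integral_const_mul]
  rw [setIntegral_congr_fun measurableSet_Ioc
    (fun t ht => setIntegral_triangleKernel_left F ht)] at h
  rw [h]
  refine integral_congr_ae ?_
  rw [← restrict_Ioo_eq_restrict_Ioc]
  filter_upwards [ae_restrict_mem measurableSet_Ioo] with r hr
  rw [restrict_Ioo_eq_restrict_Ioc, setIntegral_triangleKernel_right hp hq F hr, mul_assoc]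

theorem integral_right_eq_integral_left_comp_neg (q : ℝ) (F : ℝ → ℝ) (x b : ℝ) :
    ∫ t in x..b, (t - x) ^ (q - 1) * F t =
      ∫ t in (-b)..(-x), (-x - t) ^ (q - 1) * F (-t) := by
  have h := intervalIntegral.integral_comp_neg (a := -b) (b := -x)
    (fun t => (t - x) ^ (q - 1) * F t)
  simp only [neg_neg] at h
  rw [← h]
  refine intervalIntegral.integral_congr fun t _ => ?_
  rw [show -t - x = -x - t by ring]

theorem intervalIntegrable_integral_right_rpow_mul {q : ℝ} (hq : 0 < q) {a b : ℝ} (hab : a ≤ b)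
    {F : ℝ → ℝ} (hF : IntervalIntegrable F volume a b) :
    IntervalIntegrable (fun t => ∫ r in t..b, (r - t) ^ (q - 1) * F r) volume a b := by
  have h := intervalIntegrable_integral_rpow_mul hq (neg_le_neg hab)
    (((IntervalIntegrable.iff_comp_neg (by simp)).1 hF).symm)
  refine (IntervalIntegrable.iff_comp_neg (by simp)).2 (h.symm.congr fun t _ => ?_)
  simp only [integral_right_eq_integral_left_comp_neg, neg_neg]

/-- The semigroup property of the right Riemann-Liouville integrals. -/
theorem integral_right_rpow_mul_integral_rpow_mul {p q : ℝ} (hp : 0 < p) (hq : 0 < q)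
    (hpq : 1 ≤ p + q) {x b : ℝ} (hxb : x ≤ b) {F : ℝ → ℝ} (hF : IntervalIntegrable F volume x b) :
    ∫ t in x..b, (t - x) ^ (p - 1) * ∫ r in t..b, (r - t) ^ (q - 1) * F r =
      ProbabilityTheory.beta p q * ∫ r in x..b, (r - x) ^ (p + q - 1) * F r := by
  have h := integral_rpow_mul_integral_rpow_mul hp hq hpq (neg_le_neg hxb)
    (((IntervalIntegrable.iff_comp_neg (by simp)).1 hF).symm)
  rw [integral_right_eq_integral_left_comp_neg,
    integral_right_eq_integral_left_comp_neg (p + q), ← h]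
  refine intervalIntegral.integral_congr fun t _ => ?_
  simp only [integral_right_eq_integral_left_comp_neg, neg_neg]

/-! ### Inversion of the fractional derivatives -/

theorem beta_self_one_sub (α : ℝ) :
    ProbabilityTheory.beta α (1 - α) = Real.Gamma α * Real.Gamma (1 - α) := by
  simp [ProbabilityTheory.beta]

theorem intervalIntegrable_caputoDerivRight {α a b : ℝ} (hα1 : α ≤ 1) (hab : a ≤ b) {f : ℝ → ℝ}
    (hf : AbsolutelyContinuousOnInterval f a b) :
    IntervalIntegrable (caputoDerivRight α b f) volume a b := by
  have hf' := hf.intervalIntegrable_deriv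
  unfold caputoDerivRight rlIntegralRight
  split_ifs with h
  · exact hf'.neg
  · have hβ : 0 < 1 - α := lt_of_le_of_ne (by linarith) (Ne.symm h)
    exact ((intervalIntegrable_integral_right_rpow_mul hβ hab hf').const_mul _).neg

/-- The right Riemann-Liouville integral of order `α` inverts the right Caputo derivative. -/
theorem integral_rpow_mul_caputoDerivRight {α a b : ℝ} (hα : 0 < α) (hα1 : α ≤ 1) {f : ℝ → ℝ}
    (hf : AbsolutelyContinuousOnInterval f a b) (hfb : f b = 0) {x : ℝ} (hx : x ∈ Icc a b) :
    ∫ t in x..b, (t - x) ^ (α - 1) * caputoDerivRight α b f t = Real.Gamma α * f x := by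
  have hab : a ≤ b := hx.1.trans hx.2
  have hfx : AbsolutelyContinuousOnInterval f x b := hf.mono (by
    rw [uIcc_of_le hx.2, uIcc_of_le hab]; exact Icc_subset_Icc_left hx.1)
  have hf' := hfx.intervalIntegrable_deriv
  have hFTC := hfx.integral_deriv_eq_sub
  rw [hfb, zero_sub] at hFTC
  unfold caputoDerivRight rlIntegralRight
  split_ifs with h
  · obtain rfl : α = 1 := by linarith
    simp [hFTC]
  · have hβ : 0 < 1 - α := lt_of_le_of_ne (by linarith) (Ne.symm h)
    have hG := (Real.Gamma_pos_of_pos hβ).ne'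
    have hc := integral_right_rpow_mul_integral_rpow_mul hα hβ (by linarith) hx.2 hf'
    rw [beta_self_one_sub] at hc
    simp only [add_sub_cancel, sub_self, Real.rpow_zero, one_mul, hFTC] at hc
    have : ∀ t, (t - x) ^ (α - 1) *
        -((Real.Gamma (1 - α))⁻¹ * ∫ r in t..b, (r - t) ^ (1 - α - 1) * deriv f r) =
        (-(Real.Gamma (1 - α))⁻¹) *
          ((t - x) ^ (α - 1) * ∫ r in t..b, (r - t) ^ (1 - α - 1) * deriv f r) := by
      intro t; ring
    simp only [this]
    rw [intervalIntegral.integral_const_mul, hc]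
    field_simp

/-- A locally absolutely continuous function on `(a,b)` with integrable derivative is, up to a
constant, the integral of its derivative from the left endpoint. -/
theorem exists_eq_add_integral_deriv {a b : ℝ} (hab : a < b) {g : ℝ → ℝ}
    (hg : ∀ c d : ℝ, a < c → c < d → d < b → AbsolutelyContinuousOnInterval g c d)
    (hg' : IntervalIntegrable (deriv g) volume a b) :
    ∃ c, ∀ x ∈ Ioo a b, g x = c + ∫ t in a..x, deriv g t := by
  obtain ⟨m, ham, hmb⟩ := exists_between hab
  have hint : ∀ x ∈ Ioo a b, IntervalIntegrable (deriv g) volume a x := fun x hx =>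
    hg'.mono_set (by
      rw [uIcc_of_le hx.1.le, uIcc_of_le hab.le]; exact Icc_subset_Icc_right hx.2.le)
  have hdiff : ∀ x ∈ Ioo a b, ∫ t in m..x, deriv g t = g x - g m := by
    intro x hx
    rcases lt_trichotomy m x with h | rfl | h
    · exact (hg m x ham h hx.2).integral_deriv_eq_sub
    · simp
    · exact (hg x m hx.1 h hmb).symm.integral_deriv_eq_sub
  refine ⟨g m - ∫ t in a..m, deriv g t, fun x hx => ?_⟩
  have h1 := intervalIntegral.integral_interval_sub_left (hint x hx) (hint m ⟨ham, hmb⟩)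
  rw [hdiff x hx] at h1
  linarith

theorem ae_eq_of_integral_eq {a b : ℝ} (hab : a ≤ b) {v w : ℝ → ℝ}
    (hv : IntervalIntegrable v volume a b) (hw : IntervalIntegrable w volume a b)
    (h : ∀ x ∈ Ioo a b, ∫ t in a..x, v t = ∫ t in a..x, w t) :
    v =ᵐ[volume.restrict (Ioc a b)] w := by
  rw [← restrict_Ioo_eq_restrict_Ioc]
  filter_upwards [ae_restrict_of_ae hv.ae_hasDerivAt_integral,
    ae_restrict_of_ae hw.ae_hasDerivAt_integral, ae_restrict_mem measurableSet_Ioo] with x h1 h2 hx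
  have hx' : x ∈ uIcc a b := by rw [uIcc_of_le hab]; exact Ioo_subset_Icc_self hx
  have d1 := h1 hx' a left_mem_uIcc
  have d2 := h2 hx' a left_mem_uIcc
  refine d1.unique (d2.congr_of_eventuallyEq ?_)
  filter_upwards [Ioo_mem_nhds hx.1 hx.2] with y hy using h y hy

theorem intervalIntegrable_sub_left_rpow {p : ℝ} (hp : -1 < p) (a b c : ℝ) :
    IntervalIntegrable (fun x => (x - c) ^ p) volume a b := by
  have h := (intervalIntegral.intervalIntegrable_rpow' hp (a := a - c) (b := b - c)).comp_sub_right c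
  simpa using h

/-- Inversion of Abel's equation: if the left Riemann-Liouville integral of order `1 - α` of `v`
is locally absolutely continuous with derivative `h`, then `v` is a multiple of
`(x - a) ^ (α - 1)` plus the Riemann-Liouville integral of order `α` of `h`. -/
theorem exists_ae_eq_rpow_add_integral {α a b : ℝ} (hα : 0 < α) (hα1 : α ≤ 1) (hab : a < b)
    {v : ℝ → ℝ} (hv : IntervalIntegrable v volume a b)
    (hg : ∀ c d : ℝ, a < c → c < d → d < b →
      AbsolutelyContinuousOnInterval (rlIntegralLeft (1 - α) a v) c d)
    (hg' : IntervalIntegrable (rlDerivLeft α a v) volume a b) :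
    ∃ c, v =ᵐ[volume.restrict (Ioc a b)] fun x =>
      c * (x - a) ^ (α - 1) +
        (Real.Gamma α)⁻¹ * ∫ t in a..x, (x - t) ^ (α - 1) * rlDerivLeft α a v t := by
  change IntervalIntegrable (deriv (rlIntegralLeft (1 - α) a v)) volume a b at hg'
  obtain ⟨c, hc⟩ := exists_eq_add_integral_deriv hab hg hg'
  change ∃ c, v =ᵐ[volume.restrict (Ioc a b)] fun x =>
      c * (x - a) ^ (α - 1) + (Real.Gamma α)⁻¹ *
        ∫ t in a..x, (x - t) ^ (α - 1) * deriv (rlIntegralLeft (1 - α) a v) t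
  set h := deriv (rlIntegralLeft (1 - α) a v) with hh
  have hGα := (Real.Gamma_pos_of_pos hα).ne'
  rcases hα1.eq_or_lt with rfl | hα1
  · refine ⟨c, ?_⟩
    rw [← restrict_Ioo_eq_restrict_Ioc]
    filter_upwards [ae_restrict_mem measurableSet_Ioo] with x hx
    have := hc x hx
    simpa [rlIntegralLeft] using this
  have hβ : 0 < 1 - α := by linarith
  have hGβ := (Real.Gamma_pos_of_pos hβ).ne'
  have hw1 := (intervalIntegrable_sub_left_rpow (p := α - 1) (by linarith) a b a).const_mul
    (c * (Real.Gamma α)⁻¹)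
  have hw2 := (intervalIntegrable_integral_rpow_mul hα hab.le hg').const_mul (Real.Gamma α)⁻¹
  refine ⟨c * (Real.Gamma α)⁻¹, ae_eq_of_integral_eq hab.le hv (hw1.add hw2) fun x hx => ?_⟩
  have hsub : uIcc a x ⊆ uIcc a b := by
    rw [uIcc_of_le hx.1.le, uIcc_of_le hab.le]; exact Icc_subset_Icc_right hx.2.le
  have hvx := hv.mono_set hsub
  have hhx := hg'.mono_set hsub
  have e1 := integral_rpow_mul_integral_rpow_mul hα hβ (by linarith) hx.1.le hvx
  have e2 := integral_rpow_mul_integral_rpow_mul hα one_pos (by linarith) hx.1.le hhx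
  have e3 := integral_rpow_mul_integral_rpow_mul one_pos hα (by linarith) hx.1.le hhx
  rw [beta_self_one_sub] at e1
  have hb : ProbabilityTheory.beta 1 α = ProbabilityTheory.beta α 1 := by
    unfold ProbabilityTheory.beta; rw [mul_comm, add_comm]
  rw [hb, add_comm 1 α, ← e2] at e3
  simp only [add_sub_cancel, sub_self, Real.rpow_zero, one_mul] at e1 e3
  have e4 : ∫ t in a..x, (x - t) ^ (α - 1) * ∫ r in a..t, (t - r) ^ (1 - α - 1) * v r =
      ∫ t in a..x, Real.Gamma (1 - α) * (c * (x - t) ^ (α - 1) +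
        (x - t) ^ (α - 1) * ∫ r in a..t, h r) := by
    refine intervalIntegral.integral_congr_ae ?_
    have : ∀ᵐ t : ℝ, t ≠ x := by simp [ae_iff]
    filter_upwards [this] with t htx ht
    rw [uIoc_of_le hx.1.le] at ht
    have := hc t ⟨ht.1, ht.2.trans_lt hx.2⟩
    rw [rlIntegralLeft, if_neg hβ.ne'] at this
    rw [inv_mul_eq_iff_eq_mul₀ hGβ] at this
    rw [this]; ring
  have hi1 : IntervalIntegrable (fun t => c * (x - t) ^ (α - 1)) volume a x := by
    have h := (intervalIntegral.intervalIntegrable_rpow' (r := α - 1) (by linarith)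
      (a := x - a) (b := x - x)).comp_sub_left x
    simpa using h.const_mul c
  have hi2 : IntervalIntegrable (fun t => (x - t) ^ (α - 1) * ∫ r in a..t, h r) volume a x := by
    have hcont : ContinuousOn (fun t => ∫ r in a..t, h r) (uIcc a x) :=
      intervalIntegral.continuousOn_primitive_interval' hhx left_mem_uIcc
    have h := (intervalIntegral.intervalIntegrable_rpow' (r := α - 1) (by linarith)
      (a := x - a) (b := x - x)).comp_sub_left x
    simp only [sub_sub_cancel] at h
    exact h.mul_continuousOn hcont
  rw [e4, intervalIntegral.integral_const_mul, intervalIntegral.integral_add hi1 hi2,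
    intervalIntegral.integral_const_mul] at e1
  have e5 : ∫ t in a..x, (x - t) ^ (α - 1) = ∫ t in a..x, (t - a) ^ (α - 1) := by
    rw [intervalIntegral.integral_comp_sub_left (fun t => t ^ (α - 1)),
      intervalIntegral.integral_comp_sub_right (fun t => t ^ (α - 1))]
    simp
  rw [intervalIntegral.integral_add (hw1.mono_set hsub) (hw2.mono_set hsub),
    intervalIntegral.integral_const_mul, intervalIntegral.integral_const_mul, e3, ← e5]
  have e6 : (Real.Gamma (1 - α))  * (c * (∫ t in a..x, (x - t) ^ (α - 1)) +
      ∫ t in a..x, (x - t) ^ (α - 1) * ∫ r in a..t, h r) =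
      Real.Gamma (1 - α) * (Real.Gamma α * ∫ r in a..x, v r) := by
    rw [e1]; ring
  have e7 := mul_left_cancel₀ hGβ e6
  field_simp
  linarith

/-! ### The reproducing kernel of the Riemann-Liouville integrals of `L²` functions -/

/-- The Cauchy-Schwarz inequality for real square integrable functions. -/
theorem sq_integral_mul_le {X : Type*} [MeasurableSpace X] {μ : Measure X} {f g : X → ℝ}
    (hf : MemLp f 2 μ) (hg : MemLp g 2 μ) :
    (∫ x, f x * g x ∂μ) ^ 2 ≤ (∫ x, f x ^ 2 ∂μ) * ∫ x, g x ^ 2 ∂μ := by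
  have hff := hf.integrable_sq
  have hgg := hg.integrable_sq
  have hfg : Integrable (fun x => f x * g x) μ := hf.integrable_mul hg
  have key : ∀ t : ℝ, 0 ≤ (∫ x, f x ^ 2 ∂μ) * (t * t) + (2 * ∫ x, f x * g x ∂μ) * t +
      ∫ x, g x ^ 2 ∂μ := by
    intro t
    have h0 : 0 ≤ ∫ x, (t * f x + g x) ^ 2 ∂μ := integral_nonneg fun x => sq_nonneg _
    have h1 : ∫ x, (t * f x + g x) ^ 2 ∂μ =
        ∫ x, ((t * t) * f x ^ 2 + (2 * t) * (f x * g x) + g x ^ 2) ∂μ := by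
      congr 1; ext x; ring
    have h2 : Integrable (fun x => (t * t) * f x ^ 2 + (2 * t) * (f x * g x)) μ :=
      (hff.const_mul _).add (hfg.const_mul _)
    rw [h1, integral_add h2 hgg, integral_add (hff.const_mul _) (hfg.const_mul _), integral_const_mul,
      integral_const_mul] at h0
    linarith
  have := discrim_le_zero key
  unfold discrim at this
  linarith

theorem rpow_sub_one_sq {x : ℝ} (hx : 0 ≤ x) (α : ℝ) :
    (x ^ (α - 1)) ^ 2 = x ^ (2 * α - 1 - 1) := by
  rw [← Real.rpow_natCast, ← Real.rpow_mul hx]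
  congr 1
  push_cast
  ring

/-- The kernel `(t - x) ^ (α - 1)` of the right Riemann-Liouville integral, truncated to
`x < t`. -/
def rlKernel (α x t : ℝ) : ℝ := (Ioi x).indicator (fun t => (t - x) ^ (α - 1)) t

theorem setIntegral_indicator_Ioi {a b x : ℝ} (hx : x ∈ Icc a b) (F : ℝ → ℝ) :
    ∫ t in Ioc a b, (Ioi x).indicator F t = ∫ t in x..b, F t := by
  have : Ioi x ∩ Ioc a b = Ioc x b := by
    ext t; simp only [mem_inter_iff, mem_Ioi, mem_Ioc]
    exact ⟨fun h => ⟨h.1, h.2.2⟩, fun h => ⟨h.1, hx.1.trans_lt h.1, h.2⟩⟩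
  rw [integral_indicator measurableSet_Ioi, Measure.restrict_restrict measurableSet_Ioi, this,
    intervalIntegral.integral_of_le hx.2]

theorem memLp_rlKernel {α : ℝ} (hα : 1 / 2 < α) (a b x : ℝ) :
    MemLp (rlKernel α x) 2 (volume.restrict (Ioc a b)) := by
  have hm : AEStronglyMeasurable (rlKernel α x) (volume.restrict (Ioc a b)) := by
    refine AEStronglyMeasurable.indicator ?_ measurableSet_Ioi
    exact Measurable.aestronglyMeasurable (by fun_prop)
  rw [memLp_two_iff_integrable_sq hm]
  have h := (intervalIntegrable_sub_left_rpow (p := 2 * α - 1 - 1) (by linarith) a b x).1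
  refine (h.indicator (measurableSet_Ioi (a := x))).congr (ae_of_all _ fun t => ?_)
  by_cases ht : x < t
  · simp only [rlKernel, indicator, mem_Ioi, ht, if_true]
    rw [rpow_sub_one_sq (sub_nonneg.2 ht.le)]
  · simp [rlKernel, indicator, ht]

theorem setIntegral_rlKernel_mul {a b x : ℝ} (α : ℝ) (hx : x ∈ Icc a b) (v : ℝ → ℝ) :
    ∫ t in Ioc a b, rlKernel α x t * v t = ∫ t in x..b, (t - x) ^ (α - 1) * v t := by
  rw [← setIntegral_indicator_Ioi hx]
  congr 1
  ext t
  by_cases ht : x < t <;> simp [rlKernel, indicator, ht]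

/-- `kernelK` is, up to normalisation, the Gram matrix of the functions `rlKernel α x`. -/
theorem setIntegral_rlKernel_mul_rlKernel {α a b x y : ℝ} (hα : 0 < α) (hx : x ∈ Icc a b)
    (hy : y ∈ Icc a b) :
    ∫ t in Ioc a b, rlKernel α x t * rlKernel α y t =
      Real.Gamma α ^ 2 * kernelK α b x y := by
  have hG := (Real.Gamma_pos_of_pos hα).ne'
  have hm : max x y ∈ Icc a b := ⟨hx.1.trans (le_max_left _ _), max_le hx.2 hy.2⟩
  unfold kernelK
  rw [← setIntegral_indicator_Ioi hm, ← mul_assoc, mul_one_div_cancel (pow_ne_zero 2 hG), one_mul]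
  congr 1
  ext t
  by_cases h1 : x < t <;> by_cases h2 : y < t <;> simp [rlKernel, indicator, h1, h2]

theorem kernelK_comm (α b x y : ℝ) : kernelK α b x y = kernelK α b y x := by
  unfold kernelK
  rw [max_comm]
  simp only [mul_comm]

theorem kernelK_self {α b x : ℝ} (hα : 1 / 2 < α) (hx : x ≤ b) :
    kernelK α b x x = 1 / Real.Gamma α ^ 2 * ((b - x) ^ (2 * α - 1) / (2 * α - 1)) := by
  unfold kernelK
  rw [max_self]
  congr 1
  have : ∫ r in x..b, (r - x) ^ (α - 1) * (r - x) ^ (α - 1) =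
      ∫ r in x..b, (r - x) ^ (2 * α - 1 - 1) := by
    refine intervalIntegral.integral_congr fun r hr => ?_
    rw [uIcc_of_le hx] at hr
    rw [← rpow_sub_one_sq (sub_nonneg.2 hr.1), sq]
  rw [this, intervalIntegral.integral_comp_sub_right (fun r => r ^ (2 * α - 1 - 1)),
    integral_rpow (Or.inl (by linarith)), sub_self, sub_add_cancel,
    Real.zero_rpow (by linarith), sub_zero]

theorem kernelK_self_nonneg {α b x : ℝ} (hα : 1 / 2 < α) (hx : x ≤ b) :
    0 ≤ kernelK α b x x := by
  rw [kernelK_self hα hx]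
  have := Real.rpow_nonneg (sub_nonneg.2 hx) (2 * α - 1)
  have h2 : 0 < 2 * α - 1 := by linarith
  positivity

theorem bddAbove_greenG {α a b : ℝ} (hα : 1 / 2 < α) :
    BddAbove ((fun x => greenG α a b x x) '' Ioo a b) := by
  refine ⟨kernelK α b a a, ?_⟩
  rintro _ ⟨x, hx, rfl⟩
  have hab := (hx.1.trans hx.2).le
  have h1 : kernelK α b x x ≤ kernelK α b a a := by
    rw [kernelK_self hα hx.2.le, kernelK_self hα hab]
    have h2 : 0 < 2 * α - 1 := by linarith
    have h3 : (0 : ℝ) ≤ b - x := sub_nonneg.2 hx.2.le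
    have h4 := hx.1.le
    gcongr
  have h2 : 0 ≤ kernelK α b a x * kernelK α b x a / kernelK α b a a := by
    rw [kernelK_comm α b a x]
    exact div_nonneg (mul_self_nonneg _) (kernelK_self_nonneg hα hab)
  simp only [greenG]
  linarith

/-- `greenG` is the reproducing kernel of the right Riemann-Liouville integrals of `L²` functions
that vanish at `a`: a pointwise value is the scalar product with the part of `rlKernel α x`
orthogonal to `rlKernel α a`, whose squared norm is `Γ(α)²` times the diagonal value of
`greenG`. -/
theorem sq_integral_rpow_mul_le {α a b : ℝ} (hα : 1 / 2 < α) {v : ℝ → ℝ}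
    (hv : MemLp v 2 (volume.restrict (Ioc a b)))
    (hva : ∫ t in a..b, (t - a) ^ (α - 1) * v t = 0) {x : ℝ} (hx : x ∈ Icc a b) :
    (∫ t in x..b, (t - x) ^ (α - 1) * v t) ^ 2 ≤
      Real.Gamma α ^ 2 * greenG α a b x x * ∫ t in Ioc a b, v t ^ 2 := by
  have hα0 : 0 < α := by linarith
  have ha : a ∈ Icc a b := ⟨le_rfl, hx.1.trans hx.2⟩
  set c := kernelK α b x a / kernelK α b a a with hc
  have mx := memLp_rlKernel hα a b x
  have ma := memLp_rlKernel hα a b a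
  have hk : MemLp (fun t => rlKernel α x t - c * rlKernel α a t) 2 (volume.restrict (Ioc a b)) :=
    mx.sub (ma.const_mul c)
  have h1 := sq_integral_mul_le hk hv
  have ixv : Integrable (fun t => rlKernel α x t * v t) (volume.restrict (Ioc a b)) :=
    mx.integrable_mul hv
  have iav : Integrable (fun t => rlKernel α a t * v t) (volume.restrict (Ioc a b)) :=
    ma.integrable_mul hv
  have ixx : Integrable (fun t => rlKernel α x t * rlKernel α x t) (volume.restrict (Ioc a b)) :=
    mx.integrable_mul mx
  have ixa : Integrable (fun t => rlKernel α x t * rlKernel α a t) (volume.restrict (Ioc a b)) :=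
    mx.integrable_mul ma
  have iaa : Integrable (fun t => rlKernel α a t * rlKernel α a t) (volume.restrict (Ioc a b)) :=
    ma.integrable_mul ma
  have e1 : ∫ t in Ioc a b, (rlKernel α x t - c * rlKernel α a t) * v t =
      ∫ t in x..b, (t - x) ^ (α - 1) * v t := by
    have : ∀ t, (rlKernel α x t - c * rlKernel α a t) * v t =
        rlKernel α x t * v t - c * (rlKernel α a t * v t) := fun t => by ring
    simp only [this]
    rw [integral_sub ixv (iav.const_mul c), integral_const_mul, setIntegral_rlKernel_mul α hx,
      setIntegral_rlKernel_mul α ha, hva, mul_zero, sub_zero]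
  have e2 : ∫ t in Ioc a b, (rlKernel α x t - c * rlKernel α a t) ^ 2 =
      Real.Gamma α ^ 2 * greenG α a b x x := by
    have : ∀ t, (rlKernel α x t - c * rlKernel α a t) ^ 2 =
        rlKernel α x t * rlKernel α x t - (2 * c) * (rlKernel α x t * rlKernel α a t) +
          c ^ 2 * (rlKernel α a t * rlKernel α a t) := fun t => by ring
    simp only [this]
    have h2 : Integrable (fun t => rlKernel α x t * rlKernel α x t -
        (2 * c) * (rlKernel α x t * rlKernel α a t)) (volume.restrict (Ioc a b)) :=
      ixx.sub (ixa.const_mul _)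
    rw [integral_add h2 (iaa.const_mul _),
      integral_sub ixx (ixa.const_mul _), integral_const_mul, integral_const_mul,
      setIntegral_rlKernel_mul_rlKernel hα0 hx hx, setIntegral_rlKernel_mul_rlKernel hα0 hx ha,
      setIntegral_rlKernel_mul_rlKernel hα0 ha ha, greenG, kernelK_comm α b a x, hc]
    by_cases h0 : kernelK α b a a = 0
    · simp [h0]
    · field_simp
      ring
  rwa [e1, e2] at h1

/-! ### The energy identity in the cylinder direction -/

theorem memLp_integral_rpow_mul {α a b : ℝ} (hα : 1 / 2 < α) (hab : a ≤ b) {h : ℝ → ℝ}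
    (hh : MemLp h 2 (volume.restrict (Ioc a b))) :
    MemLp (fun x => ∫ t in a..x, (x - t) ^ (α - 1) * h t) 2 (volume.restrict (Ioc a b)) := by
  have hi : IntervalIntegrable h volume a b :=
    (intervalIntegrable_iff_integrableOn_Ioc_of_le hab).2 (hh.integrable one_le_two)
  have hα0 : 0 < α := by linarith
  have hm : AEStronglyMeasurable (fun x => ∫ t in a..x, (x - t) ^ (α - 1) * h t)
      (volume.restrict (Ioc a b)) :=
    (intervalIntegrable_integral_rpow_mul hα0 hab hi).1.aestronglyMeasurable
  refine MemLp.of_bound hm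
    (((b - a) ^ (2 * α - 1) / (2 * α - 1) + ∫ t in a..b, h t ^ 2) / 2) ?_
  have hsq : IntervalIntegrable (fun t => h t ^ 2) volume a b :=
    (intervalIntegrable_iff_integrableOn_Ioc_of_le hab).2 hh.integrable_sq
  filter_upwards [ae_restrict_mem measurableSet_Ioc] with x hx
  have hk : IntervalIntegrable (fun t => (x - t) ^ (2 * α - 1 - 1)) volume a x := by
    have h := (intervalIntegral.intervalIntegrable_rpow' (r := 2 * α - 1 - 1) (by linarith)
      (a := x - a) (b := x - x)).comp_sub_left x
    simpa using h
  have hsqx : IntervalIntegrable (fun t => h t ^ 2) volume a x := hsq.mono_set (by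
    rw [uIcc_of_le hx.1.le, uIcc_of_le hab]; exact Icc_subset_Icc_right hx.2)
  have hval : ∫ t in a..x, (x - t) ^ (2 * α - 1 - 1) = (x - a) ^ (2 * α - 1) / (2 * α - 1) := by
    rw [intervalIntegral.integral_comp_sub_left (fun t => t ^ (2 * α - 1 - 1)),
      integral_rpow (Or.inl (by linarith)), sub_self, sub_add_cancel,
      Real.zero_rpow (by linarith), sub_zero]
  calc ‖∫ t in a..x, (x - t) ^ (α - 1) * h t‖
      ≤ ∫ t in a..x, ((x - t) ^ (2 * α - 1 - 1) + h t ^ 2) / 2 := by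
        refine intervalIntegral.norm_integral_le_of_norm_le hx.1.le ?_ ((hk.add hsqx).div_const 2)
        refine ae_of_all _ fun t ht => ?_
        rw [← rpow_sub_one_sq (sub_nonneg.2 ht.2), norm_mul, Real.norm_eq_abs, Real.norm_eq_abs,
          ← sq_abs ((x - t) ^ (α - 1)), ← sq_abs (h t)]
        nlinarith [sq_nonneg (|(x - t) ^ (α - 1)| - |h t|)]
    _ = ((x - a) ^ (2 * α - 1) / (2 * α - 1) + ∫ t in a..x, h t ^ 2) / 2 := by
        rw [intervalIntegral.integral_div, intervalIntegral.integral_add hk hsqx, hval]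
    _ ≤ _ := by
        have h1 : ∫ t in a..x, h t ^ 2 ≤ ∫ t in a..b, h t ^ 2 := by
          refine intervalIntegral.integral_mono_interval le_rfl hx.1.le hx.2 ?_ hsq
          exact ae_of_all _ fun t => sq_nonneg _
        have h2 : 0 < 2 * α - 1 := by linarith
        have h3 : (0 : ℝ) ≤ x - a := sub_nonneg.2 hx.1.le
        have h4 := hx.2
        gcongr

/-- The left and the right Riemann-Liouville integrals are adjoint to each other. -/
theorem integral_mul_integral_rpow_mul_comm {α a b : ℝ} (hα : 1 / 2 < α)
    {h v : ℝ → ℝ} (hh : MemLp h 2 (volume.restrict (Ioc a b)))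
    (hv : MemLp v 2 (volume.restrict (Ioc a b))) :
    ∫ x in Ioc a b, h x * ∫ t in x..b, (t - x) ^ (α - 1) * v t =
      ∫ t in Ioc a b, v t * ∫ x in a..t, (t - x) ^ (α - 1) * h x := by
  have hα0 : 0 < α := by linarith
  have hi : IntegrableOn h (Ioc a b) := hh.integrable one_le_two
  have h1 := integrable_triangleKernel one_pos hα0 (by linarith) hi
  have h2 := integrable_triangleKernel (q := 2 * α - 1) one_pos (by linarith) (by linarith) hi.abs
  have h3 := hv.integrable_sq.mul_prod hi.abs
  have hint : Integrable (Function.uncurry fun t r => triangleKernel 1 α b h (t, r) * v t)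
      ((volume.restrict (Ioc a b)).prod (volume.restrict (Ioc a b))) := by
    refine (h2.add h3).mono' (h1.aestronglyMeasurable.mul hv.aestronglyMeasurable.comp_fst)
      (ae_of_all _ ?_)
    rintro ⟨t, r⟩
    by_cases hrt : r ≤ t
    · simp only [Function.uncurry, triangleKernel, indicator, mem_ofPred_eq, hrt, if_true,
        Pi.add_apply, sub_self, Real.rpow_zero, one_mul, norm_mul, Real.norm_eq_abs]
      rw [← rpow_sub_one_sq (sub_nonneg.2 hrt), ← sq_abs ((t - r) ^ (α - 1)), ← sq_abs (v t)]
      nlinarith [mul_nonneg (abs_nonneg (h r)) (sq_nonneg (|(t - r) ^ (α - 1)| - |v t|)),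
        mul_nonneg (abs_nonneg (h r)) (sq_nonneg (|(t - r) ^ (α - 1)| + |v t|))]
    · simp only [Function.uncurry, triangleKernel, indicator, mem_ofPred_eq, hrt, if_false,
        Pi.add_apply, zero_mul, norm_zero, zero_add]
      positivity
  have hswap := integral_integral_swap hint
  refine Eq.trans ?_ (hswap.symm.trans ?_)
  · rw [← restrict_Ioo_eq_restrict_Ioc]
    refine setIntegral_congr_fun measurableSet_Ioo fun r hr => ?_
    have : ∀ t, triangleKernel 1 α b h (t, r) * v t =
        h r * (Ici r).indicator (fun t => (t - r) ^ (α - 1) * v t) t := by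
      intro t
      by_cases hrt : r ≤ t
      · simp only [triangleKernel, indicator, mem_ofPred_eq, mem_Ici, hrt, if_true, sub_self,
          Real.rpow_zero, one_mul]
        ring
      · simp [triangleKernel, indicator, hrt]
    simp only [this]
    rw [integral_const_mul, restrict_Ioo_eq_restrict_Ioc, integral_indicator measurableSet_Ici,
      Measure.restrict_restrict measurableSet_Ici, setIntegral_congr_set (Ioc_inter_Ici_ae hr.1),
      intervalIntegral.integral_of_le hr.2.le]
  · refine setIntegral_congr_fun measurableSet_Ioc fun t ht => ?_
    rw [integral_mul_const, setIntegral_triangleKernel_left h ht, sub_self, Real.rpow_zero,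
      one_mul, mul_comm]

/-- For a function `f` vanishing at both endpoints, the composition of the two fractional
derivatives applied to `f`, tested against `f`, is nonnegative, and it dominates the pointwise
values of `f` through the diagonal of the Green function. -/
theorem sq_le_greenG_mul_integral {α a b : ℝ} (hα : 1 / 2 < α) (hα1 : α ≤ 1) (hab : a < b)
    {f : ℝ → ℝ} (hf : IsAdmissible α a b f) (hfa : f a = 0) (hfb : f b = 0)
    (hh : MemLp (rlDerivLeft α a (caputoDerivRight α b f)) 2 (volume.restrict (Ioo a b))) :
    0 ≤ ∫ x in Ioo a b, rlDerivLeft α a (caputoDerivRight α b f) x * f x ∧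
    ∀ x ∈ Ioo a b, f x ^ 2 ≤ greenG α a b x x *
      ∫ x in Ioo a b, rlDerivLeft α a (caputoDerivRight α b f) x * f x := by
  have hα0 : 0 < α := by linarith
  have hG := Real.Gamma_pos_of_pos hα0
  rw [restrict_Ioo_eq_restrict_Ioc] at hh ⊢
  have hvi := intervalIntegrable_caputoDerivRight hα1 hab.le hf.1
  have hrepr := fun x (hx : x ∈ Icc a b) => integral_rpow_mul_caputoDerivRight hα0 hα1 hf.1 hfb hx
  have hhi : IntervalIntegrable (rlDerivLeft α a (caputoDerivRight α b f)) volume a b :=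
    (intervalIntegrable_iff_integrableOn_Ioc_of_le hab.le).2 (hh.integrable one_le_two)
  obtain ⟨c, hc⟩ := exists_ae_eq_rpow_add_integral hα0 hα1 hab hvi hf.2 hhi
  set v := caputoDerivRight α b f with hv
  set h := rlDerivLeft α a v with hhdef
  -- The singular part is square integrable because `1 / 2 < α`.
  have hka : MemLp (fun x => (x - a) ^ (α - 1)) 2 (volume.restrict (Ioc a b)) := by
    refine (memLp_rlKernel hα a b a).ae_eq ?_
    filter_upwards [ae_restrict_mem measurableSet_Ioc] with x hx
    simp [rlKernel, hx.1]
  have hvL : MemLp v 2 (volume.restrict (Ioc a b)) :=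
    ((hka.const_mul c).add ((memLp_integral_rpow_mul hα hab.le hh).const_mul _)).ae_eq hc.symm
  have ha0 : ∫ t in a..b, (t - a) ^ (α - 1) * v t = 0 := by
    rw [hrepr a ⟨le_rfl, hab.le⟩, hfa, mul_zero]
  have henergy : ∫ x in Ioc a b, h x * f x = ∫ t in Ioc a b, v t ^ 2 := by
    have hdual := integral_mul_integral_rpow_mul_comm hα hh hvL
    have e1 : ∫ x in Ioc a b, h x * ∫ t in x..b, (t - x) ^ (α - 1) * v t =
        Real.Gamma α * ∫ x in Ioc a b, h x * f x := by
      rw [← integral_const_mul]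
      refine setIntegral_congr_fun measurableSet_Ioc fun x hx => ?_
      rw [hrepr x ⟨hx.1.le, hx.2⟩]
      ring
    have e2 : ∫ t in Ioc a b, v t * ∫ x in a..t, (t - x) ^ (α - 1) * h x =
        ∫ t in Ioc a b, (Real.Gamma α * v t ^ 2 -
          (Real.Gamma α * c) * ((t - a) ^ (α - 1) * v t)) := by
      refine integral_congr_ae ?_
      filter_upwards [hc] with t ht
      have : ∫ x in a..t, (t - x) ^ (α - 1) * h x =
          Real.Gamma α * (v t - c * (t - a) ^ (α - 1)) := by
        rw [ht]; field_simp; ring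
      rw [this]
      ring
    have hkv : Integrable (fun t => (t - a) ^ (α - 1) * v t) (volume.restrict (Ioc a b)) :=
      hka.integrable_mul hvL
    rw [e1, e2, integral_sub (hvL.integrable_sq.const_mul _) (hkv.const_mul _), integral_const_mul, integral_const_mul,
      ← intervalIntegral.integral_of_le hab.le, ← intervalIntegral.integral_of_le hab.le,
      ← intervalIntegral.integral_of_le hab.le] at hdual
    rw [ha0, mul_zero, sub_zero, intervalIntegral.integral_of_le hab.le,
      intervalIntegral.integral_of_le hab.le] at hdual
    exact mul_left_cancel₀ hG.ne' hdual
  rw [henergy]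
  refine ⟨integral_nonneg fun t => sq_nonneg _, fun x hx => ?_⟩
  have hx' := Ioo_subset_Icc_self hx
  have hCS := sq_integral_rpow_mul_le hα hvL ha0 hx'
  rw [hrepr x hx', mul_pow, mul_assoc] at hCS
  exact le_of_mul_le_mul_left hCS (by positivity)

/-! ### The energy space -/

theorem sq_norm_toLp {X : Type*} [MeasurableSpace X] {μ : Measure X} {f : X → ℝ}
    (hf : MemLp f 2 μ) : ‖hf.toLp f‖ ^ 2 = ∫ x, f x ^ 2 ∂μ := by
  rw [← real_inner_self_eq_norm_sq, L2.inner_def]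
  refine integral_congr_ae ?_
  filter_upwards [hf.coeFn_toLp] with x hx
  rw [hx, real_inner_self_eq_norm_sq, Real.norm_eq_abs, sq_abs]

theorem eLpNorm_two_eq {X : Type*} [MeasurableSpace X] {μ : Measure X} {f : X → ℝ}
    (hf : MemLp f 2 μ) : eLpNorm f 2 μ = ENNReal.ofReal √(∫ x, f x ^ 2 ∂μ) := by
  rw [← sq_norm_toLp hf, Real.sqrt_sq (norm_nonneg _), Lp.norm_toLp,
    ENNReal.ofReal_toReal hf.eLpNorm_ne_top]

variable {N : ℕ}

/-- The difference quotient whose `L²(ℝ^N × ℝ^N)` norm is the Gagliardo seminorm. -/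
def fracDiff (s : ℝ) (f : EuclideanSpace ℝ (Fin N) → ℝ)
    (p : EuclideanSpace ℝ (Fin N) × EuclideanSpace ℝ (Fin N)) : ℝ :=
  (f p.1 - f p.2) / ‖p.1 - p.2‖ ^ (((N : ℝ) + 2 * s) / 2)

theorem fracDiff_mul_fracDiff (s : ℝ) (f g : EuclideanSpace ℝ (Fin N) → ℝ)
    (p : EuclideanSpace ℝ (Fin N) × EuclideanSpace ℝ (Fin N)) :
    fracDiff s f p * fracDiff s g p =
      (f p.1 - f p.2) * (g p.1 - g p.2) / ‖p.1 - p.2‖ ^ ((N : ℝ) + 2 * s) := by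
  unfold fracDiff
  rw [div_mul_div_comm, ← sq, ← Real.rpow_natCast, ← Real.rpow_mul (norm_nonneg _)]
  congr 2
  push_cast
  ring

theorem fracDiff_sq (s : ℝ) (f : EuclideanSpace ℝ (Fin N) → ℝ)
    (p : EuclideanSpace ℝ (Fin N) × EuclideanSpace ℝ (Fin N)) :
    fracDiff s f p ^ 2 = (f p.1 - f p.2) ^ 2 / ‖p.1 - p.2‖ ^ ((N : ℝ) + 2 * s) := by
  rw [sq, fracDiff_mul_fracDiff, sq]

theorem fracDiff_add_mul (s t : ℝ) (f g : EuclideanSpace ℝ (Fin N) → ℝ)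
    (p : EuclideanSpace ℝ (Fin N) × EuclideanSpace ℝ (Fin N)) :
    fracDiff s (fun y => f y + t * g y) p = fracDiff s f p + t * fracDiff s g p := by
  unfold fracDiff
  ring

theorem fracDiff_sub (s : ℝ) (f g : EuclideanSpace ℝ (Fin N) → ℝ) :
    fracDiff s (fun y => f y - g y) = fracDiff s f - fracDiff s g := by
  ext p
  simp only [fracDiff, Pi.sub_apply]
  ring

theorem energyForm_eq (C s : ℝ) (f g : EuclideanSpace ℝ (Fin N) → ℝ) :
    energyForm C s f g = C / 2 * ∫ p, fracDiff s f p * fracDiff s g p := by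
  simp only [energyForm, fracDiff_mul_fracDiff]

theorem aestronglyMeasurable_fracDiff (s : ℝ) {f : EuclideanSpace ℝ (Fin N) → ℝ}
    (hf : AEStronglyMeasurable f volume) : AEStronglyMeasurable (fracDiff s f) volume := by
  have h : AEStronglyMeasurable (fun p : EuclideanSpace ℝ (Fin N) × EuclideanSpace ℝ (Fin N) =>
      (f p.1 - f p.2) * (‖p.1 - p.2‖ ^ (((N : ℝ) + 2 * s) / 2))⁻¹) (volume.prod volume) := by
    refine (hf.comp_fst.sub hf.comp_snd).mul (Measurable.aestronglyMeasurable ?_)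
    fun_prop
  exact h

/-- The energy space in terms of the `L²` norms of a function and of its difference quotient. -/
theorem memEnergy_iff {s : ℝ} {Ω : Set (EuclideanSpace ℝ (Fin N))}
    {f : EuclideanSpace ℝ (Fin N) → ℝ} :
    MemEnergy s Ω f ↔ MemLp f 2 volume ∧ MemLp (fracDiff s f) 2 volume ∧
      ∀ᵐ y, y ∉ Ω → f y = 0 := by
  unfold MemEnergy
  refine and_congr_right fun hf => and_congr_left fun _ => ?_
  rw [memLp_two_iff_integrable_sq (aestronglyMeasurable_fracDiff s hf.1)]
  simp only [fracDiff_sq]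

theorem MemEnergy.memLp_fracDiff {s : ℝ} {Ω : Set (EuclideanSpace ℝ (Fin N))}
    {f : EuclideanSpace ℝ (Fin N) → ℝ} (hf : MemEnergy s Ω f) : MemLp (fracDiff s f) 2 volume :=
  (memEnergy_iff.1 hf).2.1

theorem MemEnergy.add_mul {s : ℝ} {Ω : Set (EuclideanSpace ℝ (Fin N))}
    {f g : EuclideanSpace ℝ (Fin N) → ℝ} (hf : MemEnergy s Ω f) (hg : MemEnergy s Ω g) (t : ℝ) :
    MemEnergy s Ω (fun y => f y + t * g y) := by
  refine memEnergy_iff.2 ⟨hf.1.add (hg.1.const_mul t), ?_, ?_⟩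
  · rw [funext (fracDiff_add_mul s t f g)]
    exact hf.memLp_fracDiff.add (hg.memLp_fracDiff.const_mul t)
  · filter_upwards [hf.2.2, hg.2.2] with y h1 h2 hy
    rw [h1 hy, h2 hy, mul_zero, add_zero]

theorem integral_add_mul_sq {X : Type*} [MeasurableSpace X] {μ : Measure X} {f g : X → ℝ}
    (hf : MemLp f 2 μ) (hg : MemLp g 2 μ) (t : ℝ) :
    ∫ x, (f x + t * g x) ^ 2 ∂μ =
      (∫ x, f x ^ 2 ∂μ) + 2 * t * (∫ x, f x * g x ∂μ) + t ^ 2 * ∫ x, g x ^ 2 ∂μ := by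
  have hfg : Integrable (fun x => f x * g x) μ := hf.integrable_mul hg
  have h1 : Integrable (fun x => f x ^ 2 + 2 * t * (f x * g x)) μ :=
    hf.integrable_sq.add (hfg.const_mul _)
  have : ∀ x, (f x + t * g x) ^ 2 = f x ^ 2 + 2 * t * (f x * g x) + t ^ 2 * g x ^ 2 := by
    intro x; ring
  simp only [this]
  rw [integral_add h1 (hg.integrable_sq.const_mul _),
    integral_add hf.integrable_sq (hfg.const_mul _), integral_const_mul, integral_const_mul]

/-! ### Averaging over small cubes -/

/-- The index of the cube of side `1 / k` that contains a point. -/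
def cubeIndex (k : ℕ) (y : EuclideanSpace ℝ (Fin N)) : Fin N → ℤ := fun i => ⌊(k : ℝ) * y i⌋

/-- The half-open cubes of side `1 / k` with vertices in `k⁻¹ ℤ^N`. -/
def cube (k : ℕ) (z : Fin N → ℤ) : Set (EuclideanSpace ℝ (Fin N)) := cubeIndex k ⁻¹' {z}

theorem measurableSet_cube (k : ℕ) (z : Fin N → ℤ) : MeasurableSet (cube k z) := by
  have : Measurable (cubeIndex (N := N) k) := by
    unfold cubeIndex
    refine measurable_pi_lambda _ fun i => Int.measurable_floor.comp ?_
    fun_prop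
  exact this (measurableSet_singleton z)

theorem pairwise_disjoint_cube (k : ℕ) :
    Pairwise (Function.onFun Disjoint (cube (N := N) k)) := by
  intro z w hzw
  refine Set.disjoint_left.2 fun y hy hy' => hzw ?_
  exact (mem_singleton_iff.1 hy).symm.trans (mem_singleton_iff.1 hy')

theorem volume_cube {k : ℕ} (hk : 0 < k) (z : Fin N → ℤ) :
    volume (cube k z) = ENNReal.ofReal ((1 / (k : ℝ)) ^ N) := by
  have hk' : (0 : ℝ) < k := Nat.cast_pos.2 hk
  have h1 : cube k z = WithLp.ofLp ⁻¹'
      (univ.pi fun i => Ico ((z i : ℝ) / k) (((z i : ℝ) + 1) / k)) := by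
    ext y
    simp only [cube, mem_preimage, mem_singleton_iff, funext_iff, cubeIndex, Int.floor_eq_iff,
      mem_pi, mem_univ, true_implies, mem_Ico, div_le_iff₀' hk', lt_div_iff₀' hk']
  rw [h1, (PiLp.volume_preserving_ofLp (Fin N)).measure_preimage
    (MeasurableSet.univ_pi fun i => measurableSet_Ico).nullMeasurableSet, Real.volume_pi_Ico]
  have : ∀ i, ((z i : ℝ) + 1) / k - (z i : ℝ) / k = 1 / k := fun i => by ring
  simp only [this, Finset.prod_const, Finset.card_univ, Fintype.card_fin]
  rw [ENNReal.ofReal_pow (by positivity)]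

theorem volume_real_cube {k : ℕ} (hk : 0 < k) (z : Fin N → ℤ) :
    volume.real (cube k z) = (1 / (k : ℝ)) ^ N := by
  rw [Measure.real, volume_cube hk, ENNReal.toReal_ofReal (by positivity)]

theorem norm_sub_le_of_mem_cube {k : ℕ} (hk : 0 < k) {z : Fin N → ℤ}
    {x y : EuclideanSpace ℝ (Fin N)} (hx : x ∈ cube k z) (hy : y ∈ cube k z) :
    ‖x - y‖ ≤ √N / k := by
  have hk' : (0 : ℝ) < k := Nat.cast_pos.2 hk
  rw [EuclideanSpace.norm_eq, ← Real.sqrt_sq hk'.le, ← Real.sqrt_div' _ (by positivity)]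
  refine Real.sqrt_le_sqrt ?_
  have h : ∀ i, ‖(x - y).ofLp i‖ ^ 2 ≤ 1 / (k : ℝ) ^ 2 := by
    intro i
    have h1 : ⌊(k : ℝ) * x i⌋ = z i := congrFun (mem_singleton_iff.1 hx) i
    have h2 : ⌊(k : ℝ) * y i⌋ = z i := congrFun (mem_singleton_iff.1 hy) i
    have h3 := Int.abs_sub_lt_one_of_floor_eq_floor (h1.trans h2.symm)
    rw [← mul_sub, abs_mul, abs_of_pos hk'] at h3
    have h4 : |x i - y i| ≤ 1 / k := by
      rw [le_div_iff₀' hk']; exact h3.le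
    rw [Real.norm_eq_abs, ← one_div_pow]
    exact pow_le_pow_left₀ (abs_nonneg _) h4 2
  calc ∑ i, ‖(x - y).ofLp i‖ ^ 2 ≤ ∑ _i : Fin N, 1 / (k : ℝ) ^ 2 :=
        Finset.sum_le_sum fun i _ => h i
    _ = _ := by simp [div_eq_mul_inv]

/-- A bounded set meets only finitely many cubes of a given side. -/
theorem exists_finset_subset_iUnion_cube {Ω : Set (EuclideanSpace ℝ (Fin N))}
    (hΩ : Bornology.IsBounded Ω) (k : ℕ) :
    ∃ Z : Finset (Fin N → ℤ), Ω ⊆ ⋃ z ∈ Z, cube k z := by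
  obtain ⟨R, hR⟩ := hΩ.exists_norm_le
  refine ⟨Fintype.piFinset fun _ => Finset.Icc ⌊-(k * R)⌋ ⌊k * R⌋, fun y hy => ?_⟩
  rw [mem_iUnion₂]
  refine ⟨cubeIndex k y, ?_, rfl⟩
  rw [Fintype.mem_piFinset]
  intro i
  have h1 : |y i| ≤ R := (PiLp.norm_apply_le y i).trans (hR y hy)
  have hk : (0 : ℝ) ≤ k := Nat.cast_nonneg k
  rw [abs_le] at h1
  rw [Finset.mem_Icc]
  constructor
  · refine Int.floor_le_floor ?_
    nlinarith
  · refine Int.floor_le_floor ?_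
    nlinarith

/-- The variance identity: a square integrable function on a finite measure space is controlled
by its integral and by its differences. -/
theorem measureReal_mul_integral_sq {X : Type*} [MeasurableSpace X] {μ : Measure X}
    [IsFiniteMeasure μ] {g : X → ℝ} (hg : MemLp g 2 μ) :
    μ.real univ * ∫ x, g x ^ 2 ∂μ =
      (∫ x, g x ∂μ) ^ 2 + (∫ p, (g p.1 - g p.2) ^ 2 ∂(μ.prod μ)) / 2 := by
  have hi : Integrable g μ := hg.integrable one_le_two
  have hsq := hg.integrable_sq
  have i1 : Integrable (fun p : X × X => g p.1 ^ 2) (μ.prod μ) := hsq.comp_fst μ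
  have i2 : Integrable (fun p : X × X => g p.2 ^ 2) (μ.prod μ) := hsq.comp_snd μ
  have i3 : Integrable (fun p : X × X => g p.1 * g p.2) (μ.prod μ) := hi.mul_prod hi
  have i4 : Integrable (fun p : X × X => g p.1 ^ 2 + g p.2 ^ 2) (μ.prod μ) := i1.add i2
  have : ∀ p : X × X, (g p.1 - g p.2) ^ 2 = g p.1 ^ 2 + g p.2 ^ 2 - 2 * (g p.1 * g p.2) :=
    fun p => by ring
  simp only [this]
  rw [integral_sub i4 (i3.const_mul 2), integral_add i1 i2, integral_const_mul,
    integral_prod_mul, integral_fun_fst (fun x => g x ^ 2), integral_fun_snd (fun x => g x ^ 2)]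
  simp only [smul_eq_mul]
  ring

/-- The fractional Poincaré inequality on a cube of side `1 / k`. -/
theorem setIntegral_cube_sq_le {s : ℝ} (hs : 0 < s) {k : ℕ} (hk : 0 < k) (z : Fin N → ℤ)
    {g : EuclideanSpace ℝ (Fin N) → ℝ} (hg : MemLp g 2 volume)
    (hg' : MemLp (fracDiff s g) 2 volume) :
    ∫ y in cube k z, g y ^ 2 ≤ (k : ℝ) ^ N * (∫ y in cube k z, g y) ^ 2 +
      (k : ℝ) ^ N * (√N / k) ^ ((N : ℝ) + 2 * s) *
        ∫ p in cube k z ×ˢ cube k z, fracDiff s g p ^ 2 := by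
  have hk' : (0 : ℝ) < k := Nat.cast_pos.2 hk
  have hfin : IsFiniteMeasure (volume.restrict (cube k z)) := by
    refine ⟨?_⟩
    rw [Measure.restrict_apply_univ, volume_cube hk]
    exact ENNReal.ofReal_lt_top
  have hgQ : MemLp g 2 (volume.restrict (cube k z)) := hg.restrict _
  have h1 := measureReal_mul_integral_sq hgQ
  rw [measureReal_restrict_apply_univ, volume_real_cube hk, Measure.prod_restrict] at h1
  have hp : 0 ≤ (N : ℝ) + 2 * s := by positivity
  have hd : 0 ≤ (√N / k) ^ ((N : ℝ) + 2 * s) := by positivity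
  have h2 : ∫ p in cube k z ×ˢ cube k z, (g p.1 - g p.2) ^ 2 ≤
      ∫ p in cube k z ×ˢ cube k z, (√N / k) ^ ((N : ℝ) + 2 * s) * fracDiff s g p ^ 2 := by
    refine integral_mono_of_nonneg (ae_of_all _ fun p => sq_nonneg _)
      ((hg'.integrable_sq.const_mul _).restrict) ?_
    filter_upwards [ae_restrict_mem ((measurableSet_cube k z).prod (measurableSet_cube k z))]
      with p hp'
    rw [fracDiff_sq]
    rcases eq_or_ne p.1 p.2 with h | h
    · simp [h]
    · have hn : 0 < ‖p.1 - p.2‖ := norm_pos_iff.2 (sub_ne_zero.2 h)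
      have hle := norm_sub_le_of_mem_cube hk hp'.1 hp'.2
      have := Real.rpow_le_rpow hn.le hle hp
      rw [mul_div_assoc', le_div_iff₀ (Real.rpow_pos_of_pos hn _), mul_comm]
      exact mul_le_mul_of_nonneg_right this (sq_nonneg _)
  rw [integral_const_mul] at h2
  have h3 : ∫ y in cube k z, g y ^ 2 =
      (k : ℝ) ^ N * ((1 / (k : ℝ)) ^ N * ∫ y in cube k z, g y ^ 2) := by
    rw [← mul_assoc, ← mul_pow, mul_one_div_cancel hk'.ne', one_pow, one_mul]
  rw [h3, h1, mul_assoc, ← mul_add]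
  refine mul_le_mul_of_nonneg_left ?_ (by positivity)
  have h4 : 0 ≤ ∫ p in cube k z ×ˢ cube k z, (g p.1 - g p.2) ^ 2 :=
    integral_nonneg fun p => sq_nonneg _
  change _ + (∫ p in cube k z ×ˢ cube k z, (g p.1 - g p.2) ^ 2) / 2 ≤ _
  linarith

/-- A function of the energy space is controlled in `L²` by finitely many averages, up to a small
multiple of its Gagliardo seminorm. -/
theorem integral_sq_le_sum_cube {s : ℝ} (hs : 0 < s) {k : ℕ} (hk : 0 < k)
    {Ω : Set (EuclideanSpace ℝ (Fin N))} {Z : Finset (Fin N → ℤ)} (hZ : Ω ⊆ ⋃ z ∈ Z, cube k z)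
    {g : EuclideanSpace ℝ (Fin N) → ℝ} (hg : MemEnergy s Ω g) :
    ∫ y, g y ^ 2 ≤ ∑ z ∈ Z, (k : ℝ) ^ N * (∫ y in cube k z, g y) ^ 2 +
      (k : ℝ) ^ N * (√N / k) ^ ((N : ℝ) + 2 * s) * ∫ p, fracDiff s g p ^ 2 := by
  have hg' := hg.memLp_fracDiff
  have h1 : ∫ y, g y ^ 2 = ∑ z ∈ Z, ∫ y in cube k z, g y ^ 2 := by
    rw [← integral_biUnion_finset Z (fun z _ => measurableSet_cube k z)
      ((pairwise_disjoint_cube k).set_pairwise _) fun z _ => hg.1.integrable_sq.integrableOn]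
    refine (setIntegral_eq_integral_of_ae_compl_eq_zero ?_).symm
    filter_upwards [hg.2.2] with y hy hyZ
    rw [hy fun h => hyZ (hZ h)]
    simp
  have h2 : ∑ z ∈ Z, ∫ p in cube k z ×ˢ cube k z, fracDiff s g p ^ 2 ≤
      ∫ p, fracDiff s g p ^ 2 := by
    rw [← integral_biUnion_finset Z
      (fun z _ => (measurableSet_cube k z).prod (measurableSet_cube k z)) ?_
      fun z _ => hg'.integrable_sq.integrableOn]
    · exact setIntegral_le_integral hg'.integrable_sq (ae_of_all _ fun p => sq_nonneg _)
    · intro z _ w _ hzw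
      exact Set.disjoint_prod.2 (Or.inl (pairwise_disjoint_cube k hzw))
  have hd : 0 ≤ (k : ℝ) ^ N * (√N / k) ^ ((N : ℝ) + 2 * s) := by positivity
  calc ∫ y, g y ^ 2 = ∑ z ∈ Z, ∫ y in cube k z, g y ^ 2 := h1
    _ ≤ ∑ z ∈ Z, ((k : ℝ) ^ N * (∫ y in cube k z, g y) ^ 2 +
          (k : ℝ) ^ N * (√N / k) ^ ((N : ℝ) + 2 * s) *
            ∫ p in cube k z ×ˢ cube k z, fracDiff s g p ^ 2) :=
        Finset.sum_le_sum fun z _ => setIntegral_cube_sq_le hs hk z hg.1 hg'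
    _ = ∑ z ∈ Z, (k : ℝ) ^ N * (∫ y in cube k z, g y) ^ 2 +
          (k : ℝ) ^ N * (√N / k) ^ ((N : ℝ) + 2 * s) *
            ∑ z ∈ Z, ∫ p in cube k z ×ˢ cube k z, fracDiff s g p ^ 2 := by
        rw [Finset.sum_add_distrib, Finset.mul_sum]
    _ ≤ _ := by gcongr

/-! ### Compactness and the first eigenvalue -/

open Filter Topology in
theorem tendsto_cube_const (N : ℕ) {s : ℝ} (hs : 0 < s) :
    Tendsto (fun k : ℕ => ((k + 1 : ℕ) : ℝ) ^ N * (√N / (k + 1 : ℕ)) ^ ((N : ℝ) + 2 * s))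
      atTop (𝓝 0) := by
  have h1 : Tendsto (fun k : ℕ => √N ^ ((N : ℝ) + 2 * s) * ((k + 1 : ℕ) : ℝ) ^ (-(2 * s)))
      atTop (𝓝 (√N ^ ((N : ℝ) + 2 * s) * 0)) :=
    ((tendsto_rpow_neg_atTop (by positivity)).comp
      (tendsto_natCast_atTop_atTop.comp (tendsto_add_atTop_nat 1))).const_mul _
  rw [mul_zero] at h1
  refine h1.congr fun k => ?_
  have hk : (0 : ℝ) < (k + 1 : ℕ) := by positivity
  rw [Real.div_rpow (Real.sqrt_nonneg _) hk.le, Real.rpow_add hk, Real.rpow_neg hk.le,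
    Real.rpow_natCast]
  field_simp

theorem integral_sub_sq_le {X : Type*} [MeasurableSpace X] {μ : Measure X} {f g : X → ℝ}
    (hf : MemLp f 2 μ) (hg : MemLp g 2 μ) :
    ∫ x, (f x - g x) ^ 2 ∂μ ≤ 2 * (∫ x, f x ^ 2 ∂μ) + 2 * ∫ x, g x ^ 2 ∂μ := by
  rw [← integral_const_mul, ← integral_const_mul,
    ← integral_add (hf.integrable_sq.const_mul 2) (hg.integrable_sq.const_mul 2)]
  refine integral_mono (hf.sub hg).integrable_sq
    ((hf.integrable_sq.const_mul 2).add (hg.integrable_sq.const_mul 2)) fun x => ?_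
  simp only
  nlinarith [sq_nonneg (f x + g x)]

open Filter Topology in
/-- The fractional Rellich theorem: a bounded sequence of the energy space has a subsequence that
is a Cauchy sequence in `L²`. -/
theorem exists_subseq_integral_sub_sq_le {s : ℝ} (hs : 0 < s)
    {Ω : Set (EuclideanSpace ℝ (Fin N))} (hΩ : Bornology.IsBounded Ω)
    {f : ℕ → EuclideanSpace ℝ (Fin N) → ℝ} (hf : ∀ n, MemEnergy s Ω (f n))
    (hf1 : ∀ n, ∫ y, f n y ^ 2 ≤ 1) {M : ℝ} (hM : ∀ n, ∫ p, fracDiff s (f n) p ^ 2 ≤ M) :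
    ∃ φ : ℕ → ℕ, StrictMono φ ∧ ∀ ε > 0, ∃ n₀, ∀ m n, n₀ ≤ m → n₀ ≤ n →
      ∫ y, (f (φ m) y - f (φ n) y) ^ 2 < ε := by
  -- Along a subsequence the averages over all cubes of all sides converge.
  set A : ℕ → ℕ × (Fin N → ℤ) → ℝ := fun n i => ∫ y in cube (i.1 + 1) i.2, f n y with hA
  have hAbound : ∀ n i, A n i ∈
      Icc (-(volume.real (cube (N := N) (i.1 + 1) i.2) + 1))
        (volume.real (cube (N := N) (i.1 + 1) i.2) + 1) := by
    intro n i
    set V := volume.real (cube (N := N) (i.1 + 1) i.2) with hV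
    have hV0 : 0 ≤ V := measureReal_nonneg
    have hfin : IsFiniteMeasure (volume.restrict (cube (N := N) (i.1 + 1) i.2)) := by
      refine ⟨?_⟩
      rw [Measure.restrict_apply_univ, volume_cube (Nat.succ_pos _)]
      exact ENNReal.ofReal_lt_top
    have h1 := sq_integral_mul_le ((hf n).1.restrict (cube (i.1 + 1) i.2))
      (memLp_const (1 : ℝ))
    have h2 : ∫ y in cube (i.1 + 1) i.2, f n y ^ 2 ≤ 1 :=
      (setIntegral_le_integral (hf n).1.integrable_sq (ae_of_all _ fun y => sq_nonneg _)).trans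
        (hf1 n)
    have h3 : A n i ^ 2 ≤ V := by
      simp only [mul_one, one_pow, integral_const, smul_eq_mul,
        measureReal_restrict_apply_univ] at h1
      refine h1.trans ?_
      nlinarith
    rw [mem_Icc, ← abs_le]
    refine abs_le_of_sq_le_sq (h3.trans ?_) (by positivity)
    nlinarith
  obtain ⟨L, -, φ, hφ, hL⟩ := (isCompact_univ_pi fun i : ℕ × (Fin N → ℤ) =>
    isCompact_Icc (a := -(volume.real (cube (N := N) (i.1 + 1) i.2) + 1))
      (b := volume.real (cube (N := N) (i.1 + 1) i.2) + 1)).tendsto_subseq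
        (x := A) (fun n i _ => hAbound n i)
  rw [tendsto_pi_nhds] at hL
  refine ⟨φ, hφ, fun ε hε => ?_⟩
  have hM0 : 0 ≤ M := (integral_nonneg fun p => sq_nonneg _).trans (hM 0)
  obtain ⟨k, hk⟩ : ∃ k : ℕ, ((k + 1 : ℕ) : ℝ) ^ N * (√N / (k + 1 : ℕ)) ^ ((N : ℝ) + 2 * s)
      < ε / 2 / (4 * M + 1) :=
    ((tendsto_cube_const N hs).eventually_lt_const (by positivity)).exists
  obtain ⟨Z, hZ⟩ := exists_finset_subset_iUnion_cube hΩ (k + 1)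
  have hlim : Tendsto (fun p : ℕ × ℕ => ∑ z ∈ Z, ((k + 1 : ℕ) : ℝ) ^ N *
      (A (φ p.1) (k, z) - A (φ p.2) (k, z)) ^ 2) atTop (𝓝 0) := by
    have : (0 : ℝ) = ∑ z ∈ Z, ((k + 1 : ℕ) : ℝ) ^ N * (L (k, z) - L (k, z)) ^ 2 := by simp
    rw [this, ← prod_atTop_atTop_eq]
    refine tendsto_finsetSum _ fun z _ => Tendsto.const_mul _ (Tendsto.pow ?_ 2)
    exact ((hL (k, z)).comp tendsto_fst).sub ((hL (k, z)).comp tendsto_snd)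
  obtain ⟨n₀, hn₀⟩ := eventually_atTop_prod_self.1
    (hlim.eventually_lt_const (half_pos hε))
  refine ⟨n₀, fun m n hm hn => ?_⟩
  have hsum := hn₀ m n hm hn
  have hmem : MemEnergy s Ω (fun y => f (φ m) y - f (φ n) y) := by
    have := (hf (φ m)).add_mul (hf (φ n)) (-1)
    simpa only [neg_one_mul, ← sub_eq_add_neg] using this
  have h1 := integral_sq_le_sum_cube hs (Nat.succ_pos k) hZ hmem
  have h2 : ∫ p, fracDiff s (fun y => f (φ m) y - f (φ n) y) p ^ 2 ≤ 4 * M := by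
    rw [fracDiff_sub]
    refine (integral_sub_sq_le (hf (φ m)).memLp_fracDiff (hf (φ n)).memLp_fracDiff).trans ?_
    linarith [hM (φ m), hM (φ n)]
  have h3 : ∀ z ∈ Z, ∫ y in cube (k + 1) z, (f (φ m) y - f (φ n) y) =
      A (φ m) (k, z) - A (φ n) (k, z) := by
    intro z _
    have hi : ∀ n, IntegrableOn (f n) (cube (k + 1) z) := by
      intro n
      have hfin : IsFiniteMeasure (volume.restrict (cube (N := N) (k + 1) z)) := by
        refine ⟨?_⟩
        rw [Measure.restrict_apply_univ, volume_cube (Nat.succ_pos _)]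
        exact ENNReal.ofReal_lt_top
      exact ((hf n).1.restrict _).integrable one_le_two
    exact integral_sub (hi _) (hi _)
  rw [Finset.sum_congr rfl fun z hz => by rw [Nat.succ_eq_add_one, h3 z hz]] at h1
  have hd : 0 ≤ ((k + 1 : ℕ) : ℝ) ^ N * (√N / (k + 1 : ℕ)) ^ ((N : ℝ) + 2 * s) := by positivity
  have h4 : ((k + 1 : ℕ) : ℝ) ^ N * (√N / (k + 1 : ℕ)) ^ ((N : ℝ) + 2 * s) *
      ∫ p, fracDiff s (fun y => f (φ m) y - f (φ n) y) p ^ 2 < ε / 2 := by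
    rw [lt_div_iff₀ (by positivity)] at hk
    have h5 := mul_le_mul_of_nonneg_left h2 hd
    nlinarith
  exact h1.trans_lt (by linarith)

open Filter Topology in
/-- A normalised sequence of the energy space whose squared Gagliardo seminorms converge to `m`
produces, as the `L²` limit of a subsequence, a normalised function whose squared seminorm is at
most `m`. -/
theorem exists_minimiser {s : ℝ} (hs : 0 < s) {Ω : Set (EuclideanSpace ℝ (Fin N))}
    (hΩ : Bornology.IsBounded Ω) {f : ℕ → EuclideanSpace ℝ (Fin N) → ℝ}
    (hf : ∀ n, MemEnergy s Ω (f n)) (hf1 : ∀ n, ∫ y, f n y ^ 2 = 1) {m : ℝ}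
    (hm : Tendsto (fun n => ∫ p, fracDiff s (f n) p ^ 2) atTop (𝓝 m)) :
    ∃ F, MemEnergy s Ω F ∧ ∫ y, F y ^ 2 = 1 ∧ ∫ p, fracDiff s F p ^ 2 ≤ m := by
  obtain ⟨M, hM⟩ := hm.bddAbove_range
  obtain ⟨φ, hφ, hcauchy⟩ := exists_subseq_integral_sub_sq_le hs hΩ hf (fun n => (hf1 n).le)
    (fun n => hM ⟨n, rfl⟩)
  set T : ℕ → Lp ℝ 2 (volume : Measure (EuclideanSpace ℝ (Fin N))) :=
    fun n => (hf (φ n)).1.toLp (f (φ n)) with hT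
  have hTc : CauchySeq T := by
    rw [Metric.cauchySeq_iff]
    intro ε hε
    obtain ⟨n₀, hn₀⟩ := hcauchy (ε ^ 2) (by positivity)
    refine ⟨n₀, fun i hi j hj => ?_⟩
    have h1 : dist (T i) (T j) ^ 2 < ε ^ 2 := by
      rw [dist_eq_norm, hT]
      simp only
      rw [← MemLp.toLp_sub, sq_norm_toLp]
      exact hn₀ i j hi hj
    exact lt_of_pow_lt_pow_left₀ 2 hε.le h1
  obtain ⟨G, hG⟩ := cauchySeq_tendsto_of_complete hTc
  have hGm : MemLp G 2 volume := Lp.memLp G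
  have hGself : hGm.toLp G = G := Lp.toLp_coeFn G hGm
  have hG1 : ∫ y, G y ^ 2 = 1 := by
    rw [← sq_norm_toLp hGm, hGself]
    have h1 : Tendsto (fun n => ‖T n‖ ^ 2) atTop (𝓝 (‖G‖ ^ 2)) := hG.norm.pow 2
    have h2 : ∀ n, ‖T n‖ ^ 2 = 1 := fun n => by rw [hT, sq_norm_toLp, hf1]
    simp only [h2] at h1
    exact tendsto_nhds_unique h1 tendsto_const_nhds
  obtain ⟨ψ, hψ, hae⟩ := (tendstoInMeasure_of_tendsto_Lp hG).exists_seq_tendsto_ae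
  have hcoe : ∀ᵐ y, ∀ n, T n y = f (φ n) y :=
    ae_all_iff.2 fun n => (hf (φ n)).1.coeFn_toLp
  have hlim : ∀ᵐ y, Tendsto (fun n => f (φ (ψ n)) y) atTop (𝓝 (G y)) := by
    filter_upwards [hae, hcoe] with y h1 h2
    simpa only [h2] using h1
  have hlimD : ∀ᵐ p : EuclideanSpace ℝ (Fin N) × EuclideanSpace ℝ (Fin N),
      Tendsto (fun n => fracDiff s (f (φ (ψ n))) p) atTop (𝓝 (fracDiff s G p)) := by
    have h1 := (Measure.quasiMeasurePreserving_fst (μ := volume)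
      (ν := (volume : Measure (EuclideanSpace ℝ (Fin N))))).ae hlim
    have h2 := (Measure.quasiMeasurePreserving_snd
      (μ := (volume : Measure (EuclideanSpace ℝ (Fin N)))) (ν := volume)).ae hlim
    rw [← Measure.volume_eq_prod] at h1 h2
    filter_upwards [h1, h2] with p h3 h4
    exact (h3.sub h4).div_const _
  have hmeas := aestronglyMeasurable_fracDiff s hGm.1
  -- Lower semicontinuity of the Gagliardo seminorm, by Fatou's lemma.
  have hFatou : eLpNorm (fracDiff s G) 2 volume ≤ ENNReal.ofReal √m := by
    refine (Lp.eLpNorm_lim_le_liminf_eLpNorm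
      (fun n => (hf (φ (ψ n))).memLp_fracDiff.1) _ hlimD).trans ?_
    have h1 : Tendsto (fun n => eLpNorm (fracDiff s (f (φ (ψ n)))) 2 volume) atTop
        (𝓝 (ENNReal.ofReal √m)) := by
      simp only [fun n => eLpNorm_two_eq (hf (φ (ψ n))).memLp_fracDiff]
      refine ENNReal.tendsto_ofReal (Tendsto.sqrt ?_)
      exact hm.comp ((hφ.comp hψ).tendsto_atTop)
    exact h1.liminf_eq.le
  have hGD : MemLp (fracDiff s G) 2 volume := ⟨hmeas, hFatou.trans_lt ENNReal.ofReal_lt_top⟩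
  have hm0 : 0 ≤ m := ge_of_tendsto' hm fun n => integral_nonneg fun p => sq_nonneg _
  refine ⟨G, memEnergy_iff.2 ⟨hGm, hGD, ?_⟩, hG1, ?_⟩
  · filter_upwards [hlim, ae_all_iff.2 fun n => (hf n).2.2] with y h1 h2 hy
    simp only [h2 _ hy] at h1
    exact tendsto_nhds_unique h1 tendsto_const_nhds
  · rw [eLpNorm_two_eq hGD, ENNReal.ofReal_le_ofReal_iff (Real.sqrt_nonneg _)] at hFatou
    exact (Real.sqrt_le_sqrt_iff hm0).1 hFatou

theorem setIntegral_eq_integral_mul {s : ℝ} {Ω : Set (EuclideanSpace ℝ (Fin N))}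
    {f : EuclideanSpace ℝ (Fin N) → ℝ} (hf : MemEnergy s Ω f)
    (g : EuclideanSpace ℝ (Fin N) → ℝ) : ∫ y in Ω, f y * g y = ∫ y, f y * g y := by
  refine setIntegral_eq_integral_of_ae_compl_eq_zero ?_
  filter_upwards [hf.2.2] with y hy hyΩ
  rw [hy hyΩ, zero_mul]

theorem energyForm_self_nonneg {C : ℝ} (hC : 0 ≤ C) (s : ℝ)
    (f : EuclideanSpace ℝ (Fin N) → ℝ) : 0 ≤ energyForm C s f f := by
  rw [energyForm_eq]
  exact mul_nonneg (by positivity) (integral_nonneg fun p => mul_self_nonneg _)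

theorem IsEigenvalue.nonneg {C s lam : ℝ} (hC : 0 ≤ C) {Ω : Set (EuclideanSpace ℝ (Fin N))}
    (h : IsEigenvalue C s Ω lam) : 0 ≤ lam := by
  obtain ⟨φ, hφ, hφE, -, heq⟩ := h
  have h1 := heq φ hφE
  have h2 : ∫ y in Ω, lam * φ y * φ y = lam * ∫ y in Ω, φ y ^ 2 := by
    rw [← integral_const_mul]
    congr 1; ext y; ring
  rw [h2] at h1
  have h3 := energyForm_self_nonneg hC s φ
  have h4 : 0 < ∫ y in Ω, φ y ^ 2 := by
    refine lt_of_le_of_ne (integral_nonneg fun y => sq_nonneg _) fun h0 => hφ ?_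
    have := (integral_eq_zero_iff_of_nonneg (fun y => sq_nonneg (φ y))
      (hφE.1.integrable_sq.integrableOn (s := Ω))).1 h0.symm
    filter_upwards [this] with y hy
    exact pow_eq_zero_iff two_ne_zero |>.1 hy
  rw [h1] at h3
  exact nonneg_of_mul_nonneg_left h3 h4

/-- A minimiser of the Rayleigh quotient is an eigenfunction. -/
theorem isEigenvalue_of_minimiser {C s m : ℝ} {Ω : Set (EuclideanSpace ℝ (Fin N))}
    {F : EuclideanSpace ℝ (Fin N) → ℝ} (hF : MemEnergy s Ω F) (hF1 : ∫ y, F y ^ 2 = 1)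
    (hFm : ∫ p, fracDiff s F p ^ 2 = m)
    (hmin : ∀ ψ, MemEnergy s Ω ψ → m * ∫ y, ψ y ^ 2 ≤ ∫ p, fracDiff s ψ p ^ 2) :
    IsEigenvalue C s Ω (C / 2 * m) := by
  refine ⟨F, fun h0 => ?_, hF, (hF.1.const_mul _).restrict _, fun ψ hψ => ?_⟩
  · have h1 := setIntegral_eq_integral_mul hF F
    have h2 : ∫ y in Ω, F y * F y = 0 := by
      rw [integral_congr_ae (g := fun _ => 0) (by
        filter_upwards [h0] with y hy
        simp [hy])]
      simp
    simp only [← sq] at h1 h2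
    rw [h2, hF1] at h1
    exact zero_ne_one h1
  · -- The first variation of the Rayleigh quotient in the direction `ψ` vanishes.
    have hdisc : ∀ t : ℝ, 0 ≤ ((∫ p, fracDiff s ψ p ^ 2) - m * ∫ y, ψ y ^ 2) * (t * t) +
        (2 * ((∫ p, fracDiff s F p * fracDiff s ψ p) - m * ∫ y, F y * ψ y)) * t + 0 := by
      intro t
      have h1 := hmin _ (hF.add_mul hψ t)
      rw [integral_add_mul_sq hF.1 hψ.1, funext (fracDiff_add_mul s t F ψ),
        integral_add_mul_sq hF.memLp_fracDiff hψ.memLp_fracDiff, hF1, hFm] at h1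
      linarith
    have hd := discrim_le_zero hdisc
    unfold discrim at hd
    have hzero : (∫ p, fracDiff s F p * fracDiff s ψ p) - m * ∫ y, F y * ψ y = 0 := by
      have : ((∫ p, fracDiff s F p * fracDiff s ψ p) - m * ∫ y, F y * ψ y) ^ 2 ≤ 0 := by
        linarith
      exact pow_eq_zero_iff two_ne_zero |>.1 (le_antisymm this (sq_nonneg _))
    have h2 : ∫ y in Ω, C / 2 * m * F y * ψ y = C / 2 * m * ∫ y, F y * ψ y := by
      rw [← setIntegral_eq_integral_mul hF, ← integral_const_mul]
      congr 1; ext y; ring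
    rw [energyForm_eq, h2, sub_eq_zero.1 hzero, mul_assoc]

open Filter Topology in
/-- The variational characterisation of the first eigenvalue. -/
theorem firstEigenvalue_mul_le {C s : ℝ} (hC : 0 < C) (hs : 0 < s)
    {Ω : Set (EuclideanSpace ℝ (Fin N))} (hΩ : Bornology.IsBounded Ω)
    {f : EuclideanSpace ℝ (Fin N) → ℝ} (hf : MemEnergy s Ω f) :
    firstEigenvalue C s Ω * ∫ y in Ω, f y ^ 2 ≤ energyForm C s f f := by
  have hfΩ : ∫ y in Ω, f y ^ 2 = ∫ y, f y ^ 2 := by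
    simpa only [sq] using setIntegral_eq_integral_mul hf f
  rw [hfΩ, energyForm_eq]
  simp only [← sq]
  set R : Set ℝ := {r | ∃ g, MemEnergy s Ω g ∧ ∫ y, g y ^ 2 = 1 ∧ ∫ p, fracDiff s g p ^ 2 = r}
    with hR
  have hbdd : BddBelow R := by
    refine ⟨0, ?_⟩
    rintro _ ⟨g, -, -, rfl⟩
    exact integral_nonneg fun p => sq_nonneg _
  have hnormal : ∀ g, MemEnergy s Ω g → 0 < ∫ y, g y ^ 2 →
      (∫ p, fracDiff s g p ^ 2) / (∫ y, g y ^ 2) ∈ R := by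
    intro g hg hg0
    set I := ∫ y, g y ^ 2 with hI
    have hsq : (√I)⁻¹ ^ 2 = I⁻¹ := by rw [inv_pow, Real.sq_sqrt hg0.le]
    refine ⟨fun y => (√I)⁻¹ * g y, memEnergy_iff.2 ⟨hg.1.const_mul _, ?_, ?_⟩, ?_, ?_⟩
    · have : fracDiff s (fun y => (√I)⁻¹ * g y) = fun p => (√I)⁻¹ * fracDiff s g p := by
        ext p; unfold fracDiff; ring
      rw [this]
      exact hg.memLp_fracDiff.const_mul _
    · filter_upwards [hg.2.2] with y hy hyΩ
      rw [hy hyΩ, mul_zero]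
    · simp only [mul_pow, hsq]
      rw [integral_const_mul, ← hI, inv_mul_cancel₀ hg0.ne']
    · have : ∀ p, fracDiff s (fun y => (√I)⁻¹ * g y) p ^ 2 = I⁻¹ * fracDiff s g p ^ 2 := by
        intro p; rw [← hsq]; unfold fracDiff; ring
      simp only [this]
      rw [integral_const_mul, div_eq_inv_mul]
  have hmin : ∀ g, MemEnergy s Ω g → sInf R * ∫ y, g y ^ 2 ≤ ∫ p, fracDiff s g p ^ 2 := by
    intro g hg
    rcases (integral_nonneg fun y => sq_nonneg (g y) : 0 ≤ ∫ y, g y ^ 2).eq_or_lt with h0 | h0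
    · rw [← h0, mul_zero]
      exact integral_nonneg fun p => sq_nonneg _
    · exact (le_div_iff₀ h0).1 (csInf_le hbdd (hnormal g hg h0))
  rcases (integral_nonneg fun y => sq_nonneg (f y) : 0 ≤ ∫ y, f y ^ 2).eq_or_lt with h0 | h0
  · rw [← h0, mul_zero]
    exact mul_nonneg (by positivity) (integral_nonneg fun p => sq_nonneg _)
  obtain ⟨r, -, hrlim, hr⟩ := exists_seq_tendsto_sInf ⟨_, hnormal f hf h0⟩ hbdd
  choose g hg hg1 hgr using hr
  obtain ⟨F, hF, hF1, hFm⟩ := exists_minimiser hs hΩ hg hg1 (m := sInf R)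
    (by simpa only [hgr] using hrlim)
  have hFeq : ∫ p, fracDiff s F p ^ 2 = sInf R :=
    le_antisymm hFm (csInf_le hbdd ⟨F, hF, hF1, rfl⟩)
  have heig : IsEigenvalue C s Ω (C / 2 * sInf R) := isEigenvalue_of_minimiser hF hF1 hFeq hmin
  have hle : firstEigenvalue C s Ω ≤ C / 2 * sInf R :=
    csInf_le ⟨0, fun lam h => IsEigenvalue.nonneg hC.le h⟩ heig
  calc firstEigenvalue C s Ω * ∫ y, f y ^ 2 ≤ C / 2 * sInf R * ∫ y, f y ^ 2 := by gcongr
    _ = C / 2 * (sInf R * ∫ y, f y ^ 2) := by ring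
    _ ≤ _ := mul_le_mul_of_nonneg_left (hmin f hf) (by positivity)

/-! ### Functions on the cylinder -/

theorem restrict_prod_eq_prod (a b : ℝ) (Ω : Set (EuclideanSpace ℝ (Fin N))) :
    (volume.restrict (Ioo a b ×ˢ Ω) : Measure (ℝ × EuclideanSpace ℝ (Fin N))) =
      (volume.restrict (Ioo a b)).prod (volume.restrict Ω) := by
  rw [Measure.prod_restrict, Measure.volume_eq_prod]

theorem memLp_ae_section {X Y : Type*} [MeasurableSpace X] [MeasurableSpace Y] {μ : Measure X}
    {ν : Measure Y} [SFinite μ] [SFinite ν] {f : X → Y → ℝ}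
    (hf : MemLp (Function.uncurry f) 2 (μ.prod ν)) :
    ∀ᵐ y ∂ν, MemLp (fun x => f x y) 2 μ := by
  filter_upwards [hf.1.prod_swap.prodMk_left, hf.integrable_sq.prod_left_ae] with y h1 h2
  exact (memLp_two_iff_integrable_sq h1).2 h2

/-- The energy inequality on a slice of the cylinder orthogonal to its axis. -/
theorem integral_slice_le {C s lam : ℝ} (hC : 0 < C) (hs : 0 < s)
    {Ω : Set (EuclideanSpace ℝ (Fin N))} (hΩ : Bornology.IsBounded Ω)
    {f w h : EuclideanSpace ℝ (Fin N) → ℝ} (hf : HasFracLaplacian C s Ω f w)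
    (heq : ∀ᵐ y ∂(volume.restrict Ω), h y + w y = lam * f y)
    (hhf : Integrable (fun y => h y * f y) (volume.restrict Ω)) :
    ∫ y in Ω, h y * f y ≤ (lam - firstEigenvalue C s Ω) * ∫ y in Ω, f y ^ 2 := by
  have h1 := firstEigenvalue_mul_le hC hs hΩ hf.1
  have hf2 : Integrable (fun y => f y ^ 2) (volume.restrict Ω) :=
    hf.1.1.integrable_sq.integrableOn
  have h2 : ∫ y in Ω, w y * f y = lam * (∫ y in Ω, f y ^ 2) - ∫ y in Ω, h y * f y := by
    rw [← integral_const_mul, ← integral_sub (hf2.const_mul _) hhf]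
    refine integral_congr_ae ?_
    filter_upwards [heq] with y hy
    rw [show w y = lam * f y - h y by linarith]
    ring
  rw [hf.2.2 f hf.1, h2] at h1
  linarith

end CylLyapunov

end

open CylLyapunov in
theorem theorem4p1 {N : ℕ} (hN : 0 < N) (α s C a b : ℝ)
    (hα : 1 / 2 < α) (hα1 : α ≤ 1) (hs : 0 < s) (hs1 : s < 1) (hC : 0 < C) (hab : a < b)
    (Ω : Set (EuclideanSpace ℝ (Fin N))) (hΩ : IsOpen Ω) (hΩb : Bornology.IsBounded Ω)
    (q : ℝ → ℝ) (hq : ContinuousOn q (Set.Icc a b))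
    (u : ℝ → EuclideanSpace ℝ (Fin N) → ℝ)
    (hu : CylLyapunov.IsDirichletSolution α s C a b Ω q u)
    (hu0 : ¬ (Function.uncurry u =ᵐ[MeasureTheory.volume.restrict (Set.Ioo a b ×ˢ Ω)] 0)) :
    BddAbove ((fun x => CylLyapunov.greenG α a b x x) '' Set.Ioo a b) ∧
    0 < sSup ((fun x => CylLyapunov.greenG α a b x x) '' Set.Ioo a b) ∧
    (sSup ((fun x => CylLyapunov.greenG α a b x x) '' Set.Ioo a b))⁻¹ ≤
      ∫ x in a..b, |q x - CylLyapunov.firstEigenvalue C s Ω| := by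
  have hbdd := bddAbove_greenG (a := a) (b := b) hα
  set S := sSup ((fun x => greenG α a b x x) '' Ioo a b) with hS
  have hGS : ∀ x ∈ Ioo a b, greenG α a b x x ≤ S := fun x hx =>
    le_csSup hbdd (mem_image_of_mem _ hx)
  have huL := hu.memLp
  have hhL := hu.memLp_opX
  rw [restrict_prod_eq_prod] at huL hhL hu0
  have hhu : Integrable (Function.uncurry fun x y => cylOpX α a b u x y * u x y)
      ((volume.restrict (Ioo a b)).prod (volume.restrict Ω)) := hhL.integrable_mul huL
  -- `W y` is the squared `L²` norm of the right Caputo derivative of `u(·, y)`.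
  set W : EuclideanSpace ℝ (Fin N) → ℝ := fun y => ∫ x in Ioo a b, cylOpX α a b u x y * u x y
    with hW
  have hWi : Integrable W (volume.restrict Ω) := hhu.integral_prod_right
  have hline : ∀ᵐ y ∂(volume.restrict Ω), 0 ≤ W y ∧ ∀ x ∈ Ioo a b, u x y ^ 2 ≤ S * W y := by
    filter_upwards [hu.admissible, hu.boundary, memLp_ae_section hhL] with y h1 h2 h3
    have h4 := sq_le_greenG_mul_integral hα hα1 hab h1 h2.1 h2.2 h3
    exact ⟨h4.1, fun x hx => (h4.2 x hx).trans (mul_le_mul_of_nonneg_right (hGS x hx) h4.1)⟩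
  have hnonzero : ¬ ∀ᵐ y ∂(volume.restrict Ω), S * W y ≤ 0 := by
    refine fun h0 => hu0 ?_
    have h1 := (Measure.quasiMeasurePreserving_snd (μ := volume.restrict (Ioo a b))
      (ν := volume.restrict Ω)).ae (h0.and hline)
    have h2 := (Measure.quasiMeasurePreserving_fst (μ := volume.restrict (Ioo a b))
      (ν := volume.restrict Ω)).ae (ae_restrict_mem measurableSet_Ioo)
    filter_upwards [h1, h2] with p h3 h4
    have h5 := (h3.2.2 p.1 h4).trans h3.1
    exact pow_eq_zero_iff two_ne_zero |>.1 (le_antisymm h5 (sq_nonneg _))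
  have hSpos : 0 < S := by
    by_contra hle
    refine hnonzero ?_
    filter_upwards [hline] with y hy using mul_nonpos_of_nonpos_of_nonneg (not_lt.1 hle) hy.1
  have hW0 : 0 ≤ᵐ[volume.restrict Ω] W := hline.mono fun y hy => hy.1
  have hWpos : 0 < ∫ y in Ω, W y := by
    refine lt_of_le_of_ne (integral_nonneg_of_ae hW0) fun h0 => hnonzero ?_
    filter_upwards [(integral_eq_zero_iff_of_nonneg_ae hW0 hWi).1 h0.symm] with y hy
    rw [hy, Pi.zero_apply, mul_zero]
  refine ⟨hbdd, hSpos, ?_⟩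
  obtain ⟨w, hw⟩ := hu.equation
  have hslice : ∀ᵐ x ∂(volume.restrict (Ioo a b)), ∫ y in Ω, cylOpX α a b u x y * u x y ≤
      |q x - firstEigenvalue C s Ω| * (S * ∫ y in Ω, W y) := by
    filter_upwards [hw, hhu.prod_right_ae, ae_restrict_mem measurableSet_Ioo] with x h1 h2 hx
    have h3 := integral_slice_le hC hs hΩb h1.1 h1.2 h2
    have h4 : ∫ y in Ω, u x y ^ 2 ≤ S * ∫ y in Ω, W y := by
      rw [← integral_const_mul]
      refine integral_mono_ae h1.1.1.1.integrable_sq.integrableOn (hWi.const_mul S) ?_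
      filter_upwards [hline] with y hy using hy.2 x hx
    have h5 : 0 ≤ ∫ y in Ω, u x y ^ 2 := integral_nonneg fun y => sq_nonneg _
    exact h3.trans ((mul_le_mul_of_nonneg_right (le_abs_self _) h5).trans
      (mul_le_mul_of_nonneg_left h4 (abs_nonneg _)))
  have hqi : IntervalIntegrable (fun x => |q x - firstEigenvalue C s Ω|) volume a b := by
    refine ContinuousOn.intervalIntegrable ?_
    rw [uIcc_of_le hab.le]
    exact (hq.sub continuousOn_const).abs
  have hqi' : Integrable (fun x => |q x - firstEigenvalue C s Ω|) (volume.restrict (Ioo a b)) :=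
    (intervalIntegrable_iff_integrableOn_Ioo_of_le hab.le).1 hqi
  have hmain : ∫ y in Ω, W y ≤
      (∫ x in a..b, |q x - firstEigenvalue C s Ω|) * (S * ∫ y in Ω, W y) := by
    rw [intervalIntegral.integral_of_le hab.le, ← restrict_Ioo_eq_restrict_Ioc]
    calc ∫ y in Ω, W y
        = ∫ x in Ioo a b, ∫ y in Ω, cylOpX α a b u x y * u x y :=
          (integral_integral_swap hhu).symm
      _ ≤ ∫ x in Ioo a b, |q x - firstEigenvalue C s Ω| * (S * ∫ y in Ω, W y) :=
          integral_mono_ae hhu.integral_prod_left (hqi'.mul_const _) hslice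
      _ = _ := integral_mul_const _ _
  rw [inv_le_iff_one_le_mul₀ hSpos]
  rw [← mul_assoc] at hmain
  exact le_of_mul_le_mul_right (by rwa [one_mul]) hWpos
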